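/- **Conventions.** For a unital $C^*$-algebra $\mathcal{A}$, a (possibly $+\infty$-valued) seminorm on $\mathcal{A}$ is a map $L:\mathcal{A}\to[0,+\infty]$ with $L(a+b)\le L(a)+L(b)$ and $L(\lambda a)=|\lambda|L(a)$ for $\lambda\in\mathbb{C}$ (with $0\cdot\infty=0$). On the state space $S(\mathcal{A})$ put $$\rho_L(\mu,\nu)=\sup\{|\mu(a)-\nu(a)| : a\in\mathcal{A},\ L(a)\le 1\}.$$ $L$ is called a *Lip-norm*, and $(\mathcal{A},L)$ a *$C^*$-algebraic compact quantum metric space*, if $L(a^*)=L(a)$ for all $a$, $L(a)=0$ exactly when $a\in\mathbb{C}1$, and $\rho_L$ is a metric on $S(\mathcal{A})$ which induces the $w^*$-topology. Its radius $r_{\mathcal{A}}$ is half of the diameter of $(S(\mathcal{A}),\rho_L)$. Let $G$ be a compact group with normalized Haar measure $dx$, identity $e_G$ and dual $\hat G$ (equivalence classes of continuous irreducible finite-dimensional complex representations), and let $\gamma_0\in\hat G$ be the trivial representation. Let $l:G\to\mathbb{R}$ be a length function: $l$ is continuous, $l(xy)\le l(x)+l(y)$, $l(x^{-1})=l(x)$,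 and $l(x)=0$ if and only if $x=e_G$. **Theorem.** Let $\mathcal{A}$ be a unital $C^*$-algebra, let $L$ be a (possibly $+\infty$-valued) seminorm on $\mathcal{A}$ with $L(a^*)=L(a)$ for all $a\in\mathcal{A}$, and let $\alpha$ be a strongly continuous action of $G$ on $\mathcal{A}$ by $*$-automorphisms. Assume that $L$ is finite on a dense subspace of $\mathcal{A}$ and that $L$ vanishes on $\mathbb{C}1$. Let $$L^{l}(a)=\sup\Big\{\frac{\|\alpha_x(a)-a\|}{l(x)} : x\in G,\ x\ne e_G\Big\},$$ and for continuous $\varphi:G\to\mathbb{C}$ let $\alpha_\varphi(a)=\int_G\varphi(x)\,\alpha_x(a)\,dx$ and $\|\varphi\|_1=\int_G|\varphi(x)|\,dx$. For $\gamma\in\hat G$ let $\mathcal{A}_\gamma$ be the $\gamma$-isotypic component of $\mathcal{A}$, i.e. the sum of all subrepresentations of $\mathcal{A}$ equivalent to $\gamma$; in particular $\mathcal{A}_{\gamma_0}$ is the fixed-point algebra $\mathcal{A}^\alpha$. Suppose that 1. there is a constant $C>0$ with $L^{l}\le C\cdot L$ on $\mathcal{A}$; 2. for every linear combination $\varphi$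 of finitely many characters of elements of $\hat G$, $L\circ\alpha_\varphi\le\|\varphi\|_1\cdot L$ on $\mathcal{A}$; 3. for every $\gamma\in\hat G$ with $\gamma\ne\gamma_0$, the set $\{a\in\mathcal{A}_\gamma : L(a)\le 1,\ \|a\|\le r\}$ is totally bounded for some $r>0$, and the only element $a\in\mathcal{A}_\gamma$ with $L(a)=0$ is $a=0$; 4. there is a unital $C^*$-algebra $\mathcal{B}$ containing $\mathcal{A}^\alpha$, with a Lip-norm $L_{\mathcal{B}}$ which extends the restriction of $L$ to $\mathcal{A}^\alpha$. Then $(\mathcal{A},L)$ is a $C^*$-algebraic compact quantum metric space, and $$r_{\mathcal{A}}\le r_{\mathcal{B}}+C\int_G l(x)\,dx.$$ -/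

import Mathlib

open MeasureTheory
open scoped ENNReal ComplexOrder

namespace QuantumMetric

/-- A (possibly `+∞`-valued) seminorm on a complex vector space. -/
structure ExtSeminorm (A : Type*) [AddCommGroup A] [Module ℂ A] where
  toFun : A → ℝ≥0∞
  add_le' : ∀ a b : A, toFun (a + b) ≤ toFun a + toFun b
  smul' : ∀ (c : ℂ) (a : A), toFun (c • a) = ‖c‖ₑ * toFun a

instance {A : Type*} [AddCommGroup A] [Module ℂ A] :
    CoeFun (ExtSeminorm A) (fun _ => A → ℝ≥0∞) :=
  ⟨ExtSeminorm.toFun⟩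

/-- The state space: positive linear functionals taking the value `1` at the unit, as a subset of
the dual with its weak* topology. -/
def stateSpace (A : Type*) [CStarAlgebra A] : Set (WeakDual ℂ A) :=
  {φ | (∀ a : A, 0 ≤ φ (star a * a)) ∧ φ 1 = 1}

/-- `ρ_L(μ, ν) = sup {|μ(a) - ν(a)| : L(a) ≤ 1}`. -/
noncomputable def stateDist {A : Type*} [CStarAlgebra A] (L : ExtSeminorm A)
    (μ ν : stateSpace A) : ℝ≥0∞ :=
  ⨆ (a : A) (_ : L a ≤ 1), edist ((μ : WeakDual ℂ A) a) ((ν : WeakDual ℂ A) a)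

/-- The distance `ρ_L` as an extended pseudometric on the state space. -/
noncomputable abbrev statePseudoEMetric {A : Type*} [CStarAlgebra A] (L : ExtSeminorm A) :
    PseudoEMetricSpace (stateSpace A) where
  edist := stateDist L
  edist_self μ := by simp [stateDist]
  edist_comm μ ν := by simp only [stateDist, edist_comm]
  edist_triangle μ ν κ :=
    iSup₂_le fun a ha => (edist_triangle _ ((ν : WeakDual ℂ A) a) _).trans
      (add_le_add
        (le_iSup₂ (f := fun (a : A) (_ : L a ≤ 1) =>
          edist ((μ : WeakDual ℂ A) a) ((ν : WeakDual ℂ A) a)) a ha)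
        (le_iSup₂ (f := fun (a : A) (_ : L a ≤ 1) =>
          edist ((ν : WeakDual ℂ A) a) ((κ : WeakDual ℂ A) a)) a ha))

/-- `L` is a Lip-norm on `A`, i.e. `(A, L)` is a C*-algebraic compact quantum metric space:
`L` satisfies the reality condition, vanishes exactly on the scalars, and `ρ_L` is a
(finite-valued) metric on the state space inducing the weak* topology. (Points at distance zero
coincide because the weak* topology is Hausdorff.) -/
structure IsLipNorm {A : Type*} [CStarAlgebra A] (L : ExtSeminorm A) : Prop where
  star_eq : ∀ a : A, L (star a) = L a
  eq_zero_iff : ∀ a : A, L a = 0 ↔ ∃ c : ℂ, a = algebraMap ℂ A c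
  dist_ne_top : ∀ μ ν : stateSpace A, stateDist L μ ν ≠ ∞
  topology_eq : (statePseudoEMetric L).toUniformSpace.toTopologicalSpace =
    (inferInstance : TopologicalSpace (stateSpace A))

/-- The radius of `(A, L)`: half of the diameter of the state space for `ρ_L`. -/
noncomputable def radius {A : Type*} [CStarAlgebra A] (L : ExtSeminorm A) : ℝ≥0∞ :=
  (⨆ (μ : stateSpace A) (ν : stateSpace A), stateDist L μ ν) / 2

/-- A length function on a topological group. -/
structure IsLengthFunction {G : Type*} [Group G] [TopologicalSpace G] (l : G → ℝ) : Prop where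
  continuous : Continuous l
  mul_le : ∀ x y : G, l (x * y) ≤ l x + l y
  inv_eq : ∀ x : G, l x⁻¹ = l x
  eq_zero_iff : ∀ x : G, l x = 0 ↔ x = 1

/-- A continuous irreducible representation of `G` on `ℂⁿ`. Every element of the dual of a compact
group is represented in this way. -/
structure IsContIrrep {G : Type*} [Group G] [TopologicalSpace G] {n : ℕ}
    (π : Representation ℂ G (Fin n → ℂ)) : Prop where
  irreducible : π.IsIrreducible
  continuous : ∀ v : Fin n → ℂ, Continuous fun x : G => π x v

/-- The characters `χ_γ` of the continuous irreducible representations of `G`. -/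
def irrChars (G : Type*) [Group G] [TopologicalSpace G] : Set (G → ℂ) :=
  {χ | ∃ (n : ℕ) (π : Representation ℂ G (Fin n → ℂ)), IsContIrrep π ∧ χ = π.character}

section Action

variable {G : Type*} [Group G] {A : Type*} [CStarAlgebra A]

/-- `α_φ(a) = ∫ φ(x) α_x(a) dx`. -/
noncomputable def average [MeasurableSpace G] (μ : Measure G) (α : G →* (A ≃⋆ₐ[ℂ] A))
    (φ : G → ℂ) (a : A) : A :=
  ∫ x, φ x • α x a ∂μ

/-- `L^l(a) = sup {‖α_x(a) - a‖ / l(x) : x ≠ e}`. -/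
noncomputable def lengthSeminorm (l : G → ℝ) (α : G →* (A ≃⋆ₐ[ℂ] A)) (a : A) : ℝ≥0∞ :=
  ⨆ (x : G) (_ : x ≠ 1), ENNReal.ofReal (‖α x a - a‖ / l x)

/-- The `π`-isotypic component of `A`: the sum of all subrepresentations of `A` that are
equivalent to `π`. -/
noncomputable def isotypicPart (α : G →* (A ≃⋆ₐ[ℂ] A)) {n : ℕ}
    (π : Representation ℂ G (Fin n → ℂ)) : Submodule ℂ A :=
  sSup {W : Submodule ℂ A | ∃ e : (Fin n → ℂ) ≃ₗ[ℂ] W,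
    ∀ (x : G) (v : Fin n → ℂ), (e (π x v) : A) = α x (e v : A)}

/-- The fixed-point algebra of the action. -/
noncomputable def fixedPointAlgebra (α : G →* (A ≃⋆ₐ[ℂ] A)) : StarSubalgebra ℂ A where
  carrier := {a | ∀ x : G, α x a = a}
  mul_mem' ha hb x := by rw [map_mul, ha x, hb x]
  add_mem' ha hb x := by rw [map_add, ha x, hb x]
  algebraMap_mem' c x := AlgHomClass.commutes (α x) c
  star_mem' {a} ha x := by
    change α x (star a) = star a
    rw [map_star, ha x]

end Action

end QuantumMetric

/-! Everything rests on averaging. Write `E a = ∫ α_x(a) dx`, a fixed point of the action. If `L a ≤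
1`, hypothesis 1 gives `‖α_x(a) - a‖ ≤ C l(x)`, hence `‖a - E a‖ ≤ C ∫ l`, and hypothesis 2 gives `L
(E a) ≤ 1`. Two states of `A`, restricted to the fixed-point algebra, extend to states of `B`
(`exists_state_restrict_eq`), so their distance is at most a distance for `LB` plus `2 C ∫ l`
(`stateDist_le_of_restrict_eq`). This yields both finiteness and the radius bound. If `L a = 0`,
then `a` is fixed by the action, and the Lip-norm on `B` makes it a scalar.

For the topology, the criterion is that the unit ball of `L` be, modulo scalars, within any `ε` of a
totally bounded set (`stateTopology_eq_of_totallyBounded`). Take a combination `φ` of characters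
with `∫ φ = 1` and `∫ |φ| l < ε / C` (`exists_mem_span_irrChars_concentrated`); then `α_φ` moves the
ball by at most `ε`. The image of the ball under `α_φ` is compact modulo scalars up to enlargement
(`exists_isCompact_average`): a nontrivial character sends it into an isotypic component, where
hypothesis 3 applies, and the trivial one sends it into the fixed points, governed by `B`.

The function `φ` comes from a Peter–Weyl argument: a symmetric bump at the identity is approximated
in `L²` by eigenfunctions of its own convolution operator, and averaging over conjugacy classes
turns these into combinations of characters. -/

namespace QuantumMetric

set_option linter.unusedSectionVars false

/-! ### States of a C*-algebra -/

section States

variable {A : Type*} [CStarAlgebra A]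

/-- Cauchy–Schwarz for the GNS form: `|φ(1* a)|² ≤ φ(1) φ(a* a) ≤ ‖a‖²`. -/
theorem norm_apply_le_of_mem_stateSpace {φ : WeakDual ℂ A} (hφ : φ ∈ stateSpace A) (a : A) :
    ‖φ a‖ ≤ ‖a‖ := by
  let _ := CStarAlgebra.spectralOrder A
  have _ := CStarAlgebra.spectralOrderedRing A
  let f : A →ₚ[ℂ] ℂ := PositiveLinearMap.mk₀ (φ.toLinearMap : A →ₗ[ℂ] ℂ) (by
    intro x hx
    obtain ⟨b, rfl⟩ := CStarAlgebra.nonneg_iff_eq_star_mul_self.1 hx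
    exact hφ.1 b)
  have hf : ∀ x, f x = φ x := fun _ => rfl
  have hone : ‖f.toPreGNS 1‖ = 1 := by
    have h := f.preGNS_norm_sq (f.toPreGNS 1)
    simp only [PositiveLinearMap.ofPreGNS_toPreGNS, star_one, mul_one, hf, hφ.2] at h
    have h2 : ‖f.toPreGNS 1‖ ^ 2 = 1 := by exact_mod_cast h
    exact (pow_eq_one_iff_of_nonneg (norm_nonneg _) two_ne_zero).1 h2
  have hcs := norm_inner_le_norm (𝕜 := ℂ) (f.toPreGNS 1) (f.toPreGNS a)
  rw [PositiveLinearMap.preGNS_inner_def, hone, one_mul] at hcs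
  simp only [PositiveLinearMap.ofPreGNS_toPreGNS, star_one, one_mul, hf] at hcs
  have hle : star a * a ≤ algebraMap ℝ A (‖a‖ ^ 2) := by
    have := (IsSelfAdjoint.star_mul_self a).le_algebraMap_norm_self
    rwa [CStarRing.norm_star_mul_self, ← sq] at this
  have hmono := f.monotone' hle
  have h := f.preGNS_norm_sq (f.toPreGNS a)
  simp only [PositiveLinearMap.ofPreGNS_toPreGNS] at h
  have hsq : ((‖f.toPreGNS a‖ ^ 2 : ℝ) : ℂ) ≤ ((‖a‖ ^ 2 : ℝ) : ℂ) := by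
    push_cast
    rw [h]
    refine hmono.trans (le_of_eq ?_)
    change φ _ = _
    rw [IsScalarTower.algebraMap_apply ℝ ℂ A, Algebra.algebraMap_eq_smul_one, map_smul, hφ.2]
    simp
  have hsq' : ‖f.toPreGNS a‖ ^ 2 ≤ ‖a‖ ^ 2 := by exact_mod_cast hsq
  exact hcs.trans ((sq_le_sq₀ (norm_nonneg _) (norm_nonneg _)).1 hsq')

theorem im_apply_eq_zero_of_isSelfAdjoint (φ : A →L[ℂ] ℂ) (hφ : ∀ a, ‖φ a‖ ≤ ‖a‖) (h1 : φ 1 = 1)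
    {h : A} (hh : IsSelfAdjoint h) : (φ h).im = 0 := by
  have key : ∀ t : ℝ, ((φ h).im + t) ^ 2 ≤ ‖h‖ ^ 2 + t ^ 2 := by
    intro t
    set x : A := h + ((t : ℂ) * Complex.I) • (1 : A) with hx
    have h2 : φ x = φ h + (t : ℂ) * Complex.I := by simp [hx, h1]
    have h3 : star x * x = h * h + ((t : ℂ) ^ 2) • (1 : A) := by
      have : star x = h - ((t : ℂ) * Complex.I) • (1 : A) := by
        simp [hx, hh.star_eq, sub_eq_add_neg]
      rw [this, hx]
      simp only [mul_add, sub_mul, smul_mul_assoc, mul_smul_comm, mul_one, one_mul, smul_sub, smul_smul]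
      have hI : (t : ℂ) * Complex.I * (t * Complex.I) = - (t : ℂ) ^ 2 := by
        ring_nf; simp
      rw [hI]
      module
    have h4 : ‖x‖ ^ 2 ≤ ‖h‖ ^ 2 + t ^ 2 := by
      rw [sq, ← CStarRing.norm_star_mul_self, h3]
      refine (norm_add_le _ _).trans (add_le_add ((norm_mul_le _ _).trans (sq _).ge) ?_)
      refine (norm_smul_le _ _).trans ?_
      have hn : ‖(1 : A)‖ ≤ 1 := by
        rcases subsingleton_or_nontrivial A with hs | hs
        · simp [Subsingleton.elim (1 : A) 0]
        · simp
      calc _ ≤ ‖(t : ℂ) ^ 2‖ * 1 := by gcongr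
        _ = t ^ 2 := by simp
    have h5 := hφ x
    have h6 : ((φ h).im + t) ^ 2 ≤ ‖φ x‖ ^ 2 := by
      rw [h2, ← Complex.normSq_eq_norm_sq, Complex.normSq_apply]
      simp
      nlinarith [sq_nonneg (φ h).re]
    exact h6.trans ((pow_le_pow_left₀ (norm_nonneg _) h5 2).trans h4)
  by_contra hne
  -- This `t` makes the cross term `2 t Im φ(h)` equal to `2 (‖h‖² + 1)`, too large for `key`.
  have := key ((‖h‖ ^ 2 + 1) / (φ h).im)
  have e : ((φ h).im + (‖h‖ ^ 2 + 1) / (φ h).im) ^ 2 =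
      (φ h).im ^ 2 + 2 * (‖h‖ ^ 2 + 1) + ((‖h‖ ^ 2 + 1) / (φ h).im) ^ 2 := by
    field_simp
    ring
  rw [e] at this
  nlinarith [sq_nonneg (φ h).im, sq_nonneg ‖h‖]

/-- A unital contraction is positive: for `h = a* a` the element `‖h‖ - h` has norm at most `‖h‖`,
so `‖h‖ - Re φ(h) ≤ ‖h‖`. This lets Hahn–Banach functionals serve as states. -/
theorem mem_stateSpace_of_norm_le (φ : A →L[ℂ] ℂ) (hφ : ∀ a, ‖φ a‖ ≤ ‖a‖) (h1 : φ 1 = 1) :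
    StrongDual.toWeakDual φ ∈ stateSpace A := by
  let _ := CStarAlgebra.spectralOrder A
  have _ := CStarAlgebra.spectralOrderedRing A
  refine ⟨fun a => ?_, h1⟩
  change 0 ≤ φ (star a * a)
  set h := star a * a
  have hh : IsSelfAdjoint h := .star_mul_self a
  have h0 : 0 ≤ h := star_mul_self_nonneg a
  have him := im_apply_eq_zero_of_isSelfAdjoint φ hφ h1 hh
  have hle : h ≤ algebraMap ℝ A ‖h‖ := hh.le_algebraMap_norm_self
  have hnorm : ‖algebraMap ℝ A ‖h‖ - h‖ ≤ ‖h‖ := by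
    refine (CStarAlgebra.norm_le_norm_of_nonneg_of_le (sub_nonneg.2 hle)
      (sub_le_self _ h0)).trans ?_
    rcases subsingleton_or_nontrivial A with hs | hs
    · simp [Subsingleton.elim (algebraMap ℝ A ‖h‖) 0]
    · simp
  have hφh : φ (algebraMap ℝ A ‖h‖ - h) = ‖h‖ - φ h := by
    rw [map_sub, IsScalarTower.algebraMap_apply ℝ ℂ A, Algebra.algebraMap_eq_smul_one, map_smul, h1]
    simp
  have h2 := (Complex.re_le_norm _).trans ((hφ _).trans hnorm)
  rw [hφh] at h2
  simp at h2
  exact Complex.nonneg_iff.2 ⟨h2, him.symm⟩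

theorem exists_state_norm_apply_eq [Nontrivial A] {b : A} (hb : IsSelfAdjoint b) :
    ∃ φ ∈ stateSpace A, ‖φ b‖ = ‖b‖ := by
  wlog h : ‖b‖ ∈ spectrum ℝ b generalizing b
  · have h' := (CStarAlgebra.norm_or_neg_norm_mem_spectrum hb).resolve_left h
    obtain ⟨φ, hφ, hn⟩ := this hb.neg (by rw [norm_neg, ← spectrum.neg_eq]; simpa using h')
    exact ⟨φ, hφ, by simpa using hn⟩
  rcases eq_or_ne b 0 with rfl | hb0
  · obtain ⟨g, hg, hg1⟩ := exists_dual_vector' ℂ (1 : A)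
    refine ⟨_, mem_stateSpace_of_norm_le g (fun a => by simpa [hg] using g.le_opNorm a)
      (by simpa using hg1), by simp⟩
  have hpos : 0 < ‖b‖ := norm_pos_iff.2 hb0
  have h2 : 2 * ‖b‖ ≤ ‖algebraMap ℝ A ‖b‖ + b‖ := by
    have hm : ‖b‖ + ‖b‖ ∈ spectrum ℝ (algebraMap ℝ A ‖b‖ + b) := by
      rw [← spectrum.singleton_add_eq]
      exact Set.add_mem_add rfl h
    have := spectrum.norm_le_norm_of_mem hm
    rw [Real.norm_of_nonneg (by positivity)] at this
    linarith
  -- A norming functional of `‖b‖ + b`, whose norm is at least `2‖b‖`: both terms of `‖b‖ g(1) +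
  -- g(b)` must attain their maximum `‖b‖`, so `g` is unital.
  obtain ⟨g, hg, hg1⟩ := exists_dual_vector' ℂ (algebraMap ℝ A ‖b‖ + b)
  have hgn : ∀ a, ‖g a‖ ≤ ‖a‖ := fun a => by simpa [hg] using g.le_opNorm a
  have e : g (algebraMap ℝ A ‖b‖ + b) = ‖b‖ * g 1 + g b := by
    rw [map_add, IsScalarTower.algebraMap_apply ℝ ℂ A, Algebra.algebraMap_eq_smul_one, map_smul]
    simp
  rw [e] at hg1
  have hre := congrArg Complex.re hg1
  simp at hre
  have hb1 : (g b).re ≤ ‖b‖ := (Complex.re_le_norm _).trans (hgn b)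
  have h11 : ‖g 1‖ ≤ 1 := by simpa using hgn 1
  have h1r : (g 1).re ≤ 1 := (Complex.re_le_norm _).trans h11
  have hr1 : (g 1).re = 1 := by
    refine le_antisymm h1r ?_
    by_contra hlt
    push Not at hlt
    nlinarith
  have hg1' : g 1 = 1 := by
    apply Complex.ext
    · simpa using hr1
    · have := Complex.sq_norm_sub_sq_re (g 1)
      rw [hr1] at this
      simp
      nlinarith [sq_nonneg (g 1).im, norm_nonneg (g 1)]
  refine ⟨_, mem_stateSpace_of_norm_le g hgn hg1', le_antisymm (hgn b) ?_⟩
  refine le_trans ?_ (Complex.re_le_norm _)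
  change ‖b‖ ≤ (g b).re
  rw [hr1] at hre
  linarith

theorem star_apply_of_mem_stateSpace {φ : WeakDual ℂ A} (hφ : φ ∈ stateSpace A) (a : A) :
    φ (star a) = star (φ a) := by
  have hsa : ∀ h : A, IsSelfAdjoint h → star (φ h) = φ h := fun h hh =>
    Complex.conj_eq_iff_im.2 (im_apply_eq_zero_of_isSelfAdjoint (WeakDual.toStrongDual φ)
      (norm_apply_le_of_mem_stateSpace hφ) hφ.2 hh)
  conv_lhs => rw [← realPart_add_I_smul_imaginaryPart a]
  conv_rhs => rw [← realPart_add_I_smul_imaginaryPart a]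
  simp only [star_add, star_smul, map_add, map_smul, smul_eq_mul, star_mul',
    (realPart a).2.star_eq, (imaginaryPart a).2.star_eq]
  rw [hsa _ (realPart a).2, hsa _ (imaginaryPart a).2]

theorem norm_le_two_mul_of_forall_state [Nontrivial A] {a : A} {c : ℝ}
    (h : ∀ φ ∈ stateSpace A, ‖φ a‖ ≤ c) : ‖a‖ ≤ 2 * c := by
  have hs : ∀ φ ∈ stateSpace A, ‖φ (star a)‖ ≤ c := fun φ hφ => by
    rw [star_apply_of_mem_stateSpace hφ, norm_star]; exact h φ hφ
  have hre : ‖(realPart a : A)‖ ≤ c := by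
    obtain ⟨φ, hφ, e⟩ := exists_state_norm_apply_eq (realPart a).2
    rw [← e, realPart_apply_coe, ← Complex.coe_smul, map_smul, map_add]
    calc _ = 2⁻¹ * ‖φ a + φ (star a)‖ := by rw [norm_smul]; simp
      _ ≤ 2⁻¹ * (c + c) := by
        gcongr
        exact (norm_add_le _ _).trans (add_le_add (h φ hφ) (hs φ hφ))
      _ = c := by ring
  have him : ‖(imaginaryPart a : A)‖ ≤ c := by
    obtain ⟨φ, hφ, e⟩ := exists_state_norm_apply_eq (imaginaryPart a).2
    rw [← e, imaginaryPart_apply_coe, ← Complex.coe_smul, map_smul, map_smul, map_sub]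
    calc _ = 2⁻¹ * ‖φ a - φ (star a)‖ := by rw [norm_smul, norm_smul]; simp
      _ ≤ 2⁻¹ * (c + c) := by
        gcongr
        exact (norm_sub_le _ _).trans (add_le_add (h φ hφ) (hs φ hφ))
      _ = c := by ring
  conv_lhs => rw [← realPart_add_I_smul_imaginaryPart a]
  refine (norm_add_le _ _).trans ?_
  rw [norm_smul]
  simp
  linarith

theorem isCompact_stateSpace : IsCompact (stateSpace A) := by
  refine (WeakDual.isCompact_closedBall (𝕜 := ℂ) (0 : StrongDual ℂ A) 1).of_isClosed_subset ?_ ?_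
  · have : stateSpace A = (⋂ a : A, {φ : WeakDual ℂ A | 0 ≤ φ (star a * a)}) ∩
        {φ : WeakDual ℂ A | φ 1 = 1} := by
      ext; simp [stateSpace]
    rw [this]
    refine (isClosed_iInter fun a => ?_).inter ?_
    · exact isClosed_Ici.preimage (WeakDual.eval_continuous (star a * a))
    · exact isClosed_singleton.preimage (WeakDual.eval_continuous (1 : A))
  · intro φ hφ
    simp only [Set.mem_preimage, Metric.mem_closedBall, dist_zero_right]
    refine ContinuousLinearMap.opNorm_le_bound _ zero_le_one fun a => ?_
    rw [one_mul]
    exact norm_apply_le_of_mem_stateSpace hφ a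

instance : CompactSpace (stateSpace A) := isCompact_iff_compactSpace.1 isCompact_stateSpace

end States

/-- Arzelà–Ascoli, moved to `C(X, ℂ)` along its isometry with the bounded continuous functions. -/
theorem totallyBounded_of_equicontinuous {X : Type*} [TopologicalSpace X] [CompactSpace X]
    {S : Set C(X, ℂ)} {M : ℝ} (hM : ∀ f ∈ S, ∀ x, ‖f x‖ ≤ M)
    (hS : Equicontinuous fun (f : S) (x : X) => (f : C(X, ℂ)) x) : TotallyBounded S := by
  let e := ContinuousMap.isometryEquivBoundedOfCompact X ℂ
  have hc : IsCompact (closure (e '' S)) := by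
    refine BoundedContinuousFunction.arzela_ascoli (Metric.closedBall 0 M)
      (isCompact_closedBall 0 M) _ ?_ ?_
    · rintro _ x ⟨f, hf, rfl⟩
      rw [mem_closedBall_zero_iff]
      exact hM f hf x
    · intro x₀ U hU
      filter_upwards [hS x₀ U hU] with x hx
      rintro ⟨_, f, hf, rfl⟩
      exact hx ⟨f, hf⟩
  have := totallyBounded_preimage e.isometry.isUniformInducing
    (hc.totallyBounded.subset subset_closure)
  exact this.subset (Set.subset_preimage_image _ _)

theorem continuous_edist_right {X : Type*} [PseudoEMetricSpace X] (y : X) :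
    Continuous fun x => edist x y :=
  continuous_id.edist continuous_const

theorem le_topology_of_edist_lt {X : Type*} (t : TopologicalSpace X) (P : PseudoEMetricSpace X)
    (h : ∀ y, ∀ ε : ℝ≥0∞, 0 < ε → ∀ᶠ x in @nhds X t y, edist x y < ε) :
    t ≤ P.toUniformSpace.toTopologicalSpace :=
  le_of_nhds_le_nhds fun y => Metric.nhds_basis_eball.ge_iff.2 (h y)

/-! ### Lip-norms and total boundedness (Rieffel's criterion) -/

section LipNorm

variable {A : Type*} [CStarAlgebra A] {L : ExtSeminorm A}

theorem ExtSeminorm.smul_le_one {a : A} {m : ℝ} (hm : 0 < m) (h : L a ≤ ENNReal.ofReal m) :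
    L (((m⁻¹ : ℝ) : ℂ) • a) ≤ 1 := by
  rw [L.smul']
  calc _ ≤ ENNReal.ofReal m⁻¹ * ENNReal.ofReal m := by
        gcongr
        rw [← ofReal_norm, Complex.norm_real, Real.norm_of_nonneg (by positivity)]
    _ = 1 := by rw [← ENNReal.ofReal_mul (by positivity), inv_mul_cancel₀ hm.ne']; simp

theorem edist_le_stateDist (μ ν : stateSpace A) {a : A} (ha : L a ≤ 1) :
    edist ((μ : WeakDual ℂ A) a) ((ν : WeakDual ℂ A) a) ≤ stateDist L μ ν :=
  le_iSup₂ (f := fun (a : A) (_ : L a ≤ 1) =>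
    edist ((μ : WeakDual ℂ A) a) ((ν : WeakDual ℂ A) a)) a ha

theorem nontrivial_of_state (μ : stateSpace A) : Nontrivial A :=
  ⟨⟨1, 0, fun h => one_ne_zero (α := ℂ) (by rw [← μ.2.2, h, map_zero])⟩⟩

theorem IsLipNorm.continuous_stateDist (hL : IsLipNorm L) (ν : stateSpace A) :
    Continuous fun μ => stateDist L μ ν := by
  have h : @Continuous _ _ (statePseudoEMetric L).toUniformSpace.toTopologicalSpace _
      fun μ => stateDist L μ ν := @continuous_edist_right _ (statePseudoEMetric L) ν
  rw [hL.topology_eq] at h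
  exact h

theorem continuous_of_continuous_apply {X : Type*} [TopologicalSpace X] {f : X → stateSpace A}
    (h : ∀ a : A, Continuous fun x => (f x : WeakDual ℂ A) a) : Continuous f :=
  continuous_induced_rng.2 (WeakDual.continuous_of_continuous_eval h)

/-- Evaluation of states at the elements of the algebra. -/
noncomputable def stateEval : A →+ C(stateSpace A, ℂ) where
  toFun a := ⟨fun μ => (μ : WeakDual ℂ A) a,
    (WeakDual.eval_continuous a).comp continuous_subtype_val⟩
  map_zero' := by ext; simp
  map_add' a b := by ext; simp

/-- Evaluation is bi-Lipschitz, with constants 1 and 2, so total boundedness in `A` can be tested in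
`C(S(A))`. -/
theorem isUniformInducing_stateEval [Nontrivial A] :
    IsUniformInducing (stateEval : A →+ C(stateSpace A, ℂ)) := by
  have h1 : LipschitzWith 1 (stateEval : A →+ C(stateSpace A, ℂ)) :=
    AddMonoidHomClass.lipschitz_of_bound_nnnorm _ 1 fun a => by
      rw [one_mul, ← NNReal.coe_le_coe]
      exact (ContinuousMap.norm_le _ (norm_nonneg a)).2 fun μ =>
        norm_apply_le_of_mem_stateSpace μ.2 a
  have h2 : AntilipschitzWith 2 (stateEval : A →+ C(stateSpace A, ℂ)) :=
    AddMonoidHomClass.antilipschitz_of_bound _ fun a =>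
      norm_le_two_mul_of_forall_state fun φ hφ => (stateEval a).norm_coe_le_norm ⟨φ, hφ⟩
  exact h2.isUniformInducing h1.uniformContinuous

/-- As functions on the state space, these elements are bounded by the maximum of `ρ_L(·, μ₀)` and
equicontinuous because `|μ(a) - ν(a)| ≤ ρ_L(μ, ν)`. -/
theorem IsLipNorm.totallyBounded (hL : IsLipNorm L) (μ₀ : stateSpace A) :
    TotallyBounded {a : A | L a ≤ 1 ∧ (μ₀ : WeakDual ℂ A) a = 0} := by
  have := nontrivial_of_state μ₀
  set D := {a : A | L a ≤ 1 ∧ (μ₀ : WeakDual ℂ A) a = 0}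
  obtain ⟨M, hM⟩ : ∃ M : ℝ, ∀ a ∈ D, ∀ μ : stateSpace A, ‖stateEval a μ‖ ≤ M := by
    obtain ⟨ν, -, hν⟩ := isCompact_univ.exists_isMaxOn ⟨μ₀, Set.mem_univ _⟩
      (hL.continuous_stateDist μ₀).continuousOn
    refine ⟨(stateDist L ν μ₀).toReal, fun a ha μ => ?_⟩
    have h := (edist_le_stateDist μ μ₀ ha.1).trans (hν (Set.mem_univ μ))
    rw [ha.2, edist_zero_right, ← ofReal_norm] at h
    exact (ENNReal.ofReal_le_iff_le_toReal (hL.dist_ne_top _ _)).1 h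
  have htb : TotallyBounded (stateEval '' D) := by
    refine totallyBounded_of_equicontinuous (M := M) ?_ ?_
    · rintro _ ⟨a, ha, rfl⟩ μ
      exact hM a ha μ
    · intro ν
      rw [Metric.equicontinuousAt_iff_right]
      intro ε hε
      have h0 : stateDist L ν ν < ENNReal.ofReal ε := by simpa [stateDist] using hε
      filter_upwards [(hL.continuous_stateDist ν).continuousAt.eventually (gt_mem_nhds h0)]
        with μ hμ
      rintro ⟨_, a, ha, rfl⟩
      rw [dist_comm]
      have h := (edist_le_stateDist μ ν ha.1).trans_lt hμ
      rw [edist_dist] at h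
      exact (ENNReal.ofReal_lt_ofReal_iff hε).1 h
  refine (totallyBounded_preimage isUniformInducing_stateEval htb).subset
    (Set.subset_preimage_image _ _)

theorem stateTopology_eq_of_totallyBounded (hdense : Dense {a : A | L a < ∞})
    (htb : ∀ ε : ℝ, 0 < ε → ∃ T : Set A, TotallyBounded T ∧
      ∀ a, L a ≤ 1 → ∃ c : ℂ, ∃ t ∈ T, ‖a - algebraMap ℂ A c - t‖ ≤ ε) :
    (statePseudoEMetric L).toUniformSpace.toTopologicalSpace =
      (inferInstance : TopologicalSpace (stateSpace A)) := by
  refine le_antisymm ?_ ?_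
  · rw [← continuous_id_iff_le]
    refine @continuous_of_continuous_apply A _ (stateSpace A)
      (statePseudoEMetric L).toUniformSpace.toTopologicalSpace id fun a => ?_
    refine (@EMetric.continuous_iff _ _ (statePseudoEMetric L) _ _).2 fun ν ε hε => ?_
    obtain ⟨r, hr, hrε⟩ := ENNReal.lt_iff_exists_real_btwn.1 hε
    have hr0 : 0 < r := by simpa using hrε.1
    obtain ⟨a', ha', hd⟩ := Metric.dense_iff.1 hdense a (r / 3) (by positivity)
    -- Adding 1 keeps the scaling factor positive even when `L a' = 0`.
    set m : ℝ := (L a').toReal + 1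
    have hm : 0 < m := by positivity
    have hb := ExtSeminorm.smul_le_one (L := L) (a := a') hm (by
      rw [← ENNReal.ofReal_toReal hd.ne]
      exact ENNReal.ofReal_le_ofReal (by simp [m]))
    have hδ : (0 : ℝ≥0∞) < ENNReal.ofReal (r / (3 * m)) := by
      rw [ENNReal.ofReal_pos]; positivity
    refine ⟨_, hδ, fun μ hμ => ?_⟩
    refine lt_of_le_of_lt ?_ hrε.2
    have h1 : edist ((μ : WeakDual ℂ A) (((m⁻¹ : ℝ) : ℂ) • a'))
        ((ν : WeakDual ℂ A) (((m⁻¹ : ℝ) : ℂ) • a')) ≤ ENNReal.ofReal (r / (3 * m)) :=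
      (edist_le_stateDist (L := L) μ ν hb).trans (le_of_lt hμ)
    rw [edist_dist] at h1 ⊢
    have h2 := (ENNReal.ofReal_le_ofReal_iff (by positivity)).1 h1
    refine ENNReal.ofReal_le_ofReal ?_
    rw [map_smul, map_smul, dist_eq_norm, ← smul_sub, norm_smul, Complex.norm_real,
      Real.norm_of_nonneg (by positivity)] at h2
    have h3 : ‖(μ : WeakDual ℂ A) a' - (ν : WeakDual ℂ A) a'‖ ≤ r / 3 := by
      rw [inv_mul_le_iff₀ hm] at h2
      refine h2.trans (le_of_eq ?_)
      field_simp
    have h4 : ‖a - a'‖ ≤ r / 3 := by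
      rw [norm_sub_rev, ← dist_eq_norm]; exact le_of_lt ha'
    have h5 := (norm_apply_le_of_mem_stateSpace μ.2 (a - a')).trans h4
    have h6 := (norm_apply_le_of_mem_stateSpace ν.2 (a - a')).trans h4
    change dist ((μ : WeakDual ℂ A) a) ((ν : WeakDual ℂ A) a) ≤ r
    rw [dist_eq_norm]
    have e : (μ : WeakDual ℂ A) a - (ν : WeakDual ℂ A) a =
        (μ : WeakDual ℂ A) (a - a') + ((μ : WeakDual ℂ A) a' - (ν : WeakDual ℂ A) a')
          - (ν : WeakDual ℂ A) (a - a') := by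
      rw [map_sub, map_sub]; ring
    rw [e]
    refine (norm_sub_le _ _).trans ((add_le_add_left (norm_add_le _ _) _).trans ?_)
    linarith
  · refine le_topology_of_edist_lt _ (statePseudoEMetric L) fun ν ε hε => ?_
    change ∀ᶠ μ : stateSpace A in nhds ν, stateDist L μ ν < ε
    obtain ⟨r, hr, hrε⟩ := ENNReal.lt_iff_exists_real_btwn.1 hε
    have hr0 : 0 < r := by simpa using hrε.1
    obtain ⟨T, hT, hT'⟩ := htb (r / 5) (by positivity)
    -- Replacing `a`, modulo scalars, by a point of the net costs `2r/5` for each state; closeness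
    -- on the net costs another `r/5`. Scalars cancel because states agree on them.
    obtain ⟨F, hF, hTF⟩ := Metric.totallyBounded_iff.1 hT (r / 5) (by positivity)
    have hev : ∀ᶠ μ : stateSpace A in nhds ν, ∀ f ∈ F,
        ‖(μ : WeakDual ℂ A) f - (ν : WeakDual ℂ A) f‖ < r / 5 := by
      rw [Filter.eventually_all_finite hF]
      intro f _
      have hc : Continuous fun μ : stateSpace A =>
          ‖(μ : WeakDual ℂ A) f - (ν : WeakDual ℂ A) f‖ :=
        (((WeakDual.eval_continuous f).comp continuous_subtype_val).sub continuous_const).norm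
      exact hc.continuousAt.eventually (gt_mem_nhds (by
        simp only [sub_self, norm_zero]; positivity))
    filter_upwards [hev] with μ hμ
    refine lt_of_le_of_lt ?_ hrε.2
    refine iSup₂_le fun a ha => ?_
    obtain ⟨c, t, ht, hat⟩ := hT' a ha
    obtain ⟨f, hf, htf⟩ := Set.mem_iUnion₂.1 (hTF ht)
    rw [edist_dist]
    refine ENNReal.ofReal_le_ofReal ?_
    have htf' : ‖t - f‖ ≤ r / 5 := by rw [← dist_eq_norm]; exact le_of_lt htf
    have hz : ‖a - algebraMap ℂ A c - f‖ ≤ 2 * r / 5 := by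
      have e : a - algebraMap ℂ A c - f = (a - algebraMap ℂ A c - t) + (t - f) := by abel
      rw [e]
      refine (norm_add_le _ _).trans ?_
      linarith
    set z := a - algebraMap ℂ A c - f
    have h5 := (norm_apply_le_of_mem_stateSpace μ.2 z).trans hz
    have h6 := (norm_apply_le_of_mem_stateSpace ν.2 z).trans hz
    have hc : ∀ φ : stateSpace A, (φ : WeakDual ℂ A) (algebraMap ℂ A c) = c := fun φ => by
      rw [Algebra.algebraMap_eq_smul_one, map_smul, φ.2.2]; simp
    have ea : a = z + algebraMap ℂ A c + f := by simp only [z]; abel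
    have e : (μ : WeakDual ℂ A) a - (ν : WeakDual ℂ A) a =
        (μ : WeakDual ℂ A) z + ((μ : WeakDual ℂ A) f - (ν : WeakDual ℂ A) f)
          - (ν : WeakDual ℂ A) z := by
      rw [ea, map_add, map_add, map_add, map_add, hc, hc]; ring
    rw [dist_eq_norm, e]
    refine (norm_sub_le _ _).trans ((add_le_add_left (norm_add_le _ _) _).trans ?_)
    have := hμ f hf
    linarith

theorem exists_state_extension [Nontrivial A] (p : Submodule ℂ A) (f : p →ₗ[ℂ] ℂ)
    (hf : ∀ x : p, ‖f x‖ ≤ ‖x‖) (h1 : (1 : A) ∈ p) (hf1 : f ⟨1, h1⟩ = 1) :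
    ∃ φ : stateSpace A, ∀ x : p, (φ : WeakDual ℂ A) x = f x := by
  obtain ⟨g, hg, hgn⟩ := exists_extension_norm_eq p (f.mkContinuous 1 (by simpa using hf))
  have hle : ‖g‖ ≤ 1 := by
    rw [hgn]; exact LinearMap.mkContinuous_norm_le _ zero_le_one _
  refine ⟨⟨_, mem_stateSpace_of_norm_le g (fun a => ?_) ?_⟩, hg⟩
  · exact (g.le_of_opNorm_le hle a).trans (by simp)
  · exact (hg ⟨1, h1⟩).trans hf1

end LipNorm

/-! ### Irreducible representations and contragredients -/

section Irreducible

variable {G : Type*} [Group G] {V : Type*} [AddCommGroup V] [Module ℂ V]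

theorem eq_bot_or_eq_top_of_isIrreducible {π : Representation ℂ G V} (h : π.IsIrreducible)
    (W : Submodule ℂ V) (hW : ∀ g, ∀ v ∈ W, π g v ∈ W) : W = ⊥ ∨ W = ⊤ := by
  rcases h.eq_bot_or_eq_top ⟨W, hW⟩ with h | h
  · exact Or.inl (congrArg Subrepresentation.toSubmodule h)
  · exact Or.inr (congrArg Subrepresentation.toSubmodule h)

theorem nontrivial_of_isIrreducible {π : Representation ℂ G V} (h : π.IsIrreducible) :
    Nontrivial V := by
  by_contra hV
  rw [not_nontrivial_iff_subsingleton] at hV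
  exact bot_ne_top (α := Subrepresentation π)
    (Subrepresentation.toSubmodule_injective (Subsingleton.elim _ _))

theorem isIrreducible_of_eq_bot_or_eq_top [Nontrivial V] {π : Representation ℂ G V}
    (h : ∀ W : Submodule ℂ V, (∀ g, ∀ v ∈ W, π g v ∈ W) → W = ⊥ ∨ W = ⊤) : π.IsIrreducible where
  exists_pair_ne := ⟨⊥, ⊤, fun e => bot_ne_top (α := Submodule ℂ V)
    (congrArg Subrepresentation.toSubmodule e)⟩
  eq_bot_or_eq_top W := by
    rcases h W.toSubmodule fun g v hv => W.apply_mem_toSubmodule g hv with h | h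
    · exact Or.inl (Subrepresentation.toSubmodule_injective h)
    · exact Or.inr (Subrepresentation.toSubmodule_injective h)

/-- Schur's lemma. -/
theorem exists_eq_smul_of_commute [FiniteDimensional ℂ V] {π : Representation ℂ G V}
    (h : π.IsIrreducible) (T : V →ₗ[ℂ] V) (hT : ∀ g v, π g (T v) = T (π g v)) :
    ∃ c : ℂ, ∀ v, T v = c • v := by
  have := nontrivial_of_isIrreducible h
  obtain ⟨c, hc⟩ := Module.End.exists_eigenvalue T
  refine ⟨c, fun v => ?_⟩
  have htop := (eq_bot_or_eq_top_of_isIrreducible h (Module.End.eigenspace T c)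
    fun g v hv => by
      rw [Module.End.mem_eigenspace_iff] at hv ⊢
      rw [← hT, hv, map_smul]).resolve_left hc
  exact Module.End.mem_eigenspace_iff.1 (htop ▸ Submodule.mem_top : v ∈ Module.End.eigenspace T c)

end Irreducible

section Coordinates

variable {G : Type*} [Group G] {n : ℕ} (π : Representation ℂ G (Fin n → ℂ))

theorem trace_eq_sum_apply_single (T : (Fin n → ℂ) →ₗ[ℂ] (Fin n → ℂ)) :
    LinearMap.trace ℂ _ T = ∑ i, T (Pi.single i 1) i := by
  rw [LinearMap.trace_eq_matrix_trace ℂ (Pi.basisFun ℂ (Fin n)), Matrix.trace]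
  simp

theorem character_eq_sum (x : G) : π.character x = ∑ i, π x (Pi.single i 1) i :=
  trace_eq_sum_apply_single _

/-- The contragredient of a representation on `ℂⁿ`. -/
noncomputable def contragredient : Representation ℂ G (Fin n → ℂ) where
  toFun x := (LinearMap.toMatrix' (π x⁻¹)).vecMulLinear
  map_one' := by ext; simp
  map_mul' x y := by
    apply LinearMap.ext
    intro v
    simp only [mul_inv_rev, map_mul, Module.End.mul_eq_comp, LinearMap.toMatrix'_comp,
      LinearMap.comp_apply, Matrix.vecMulLinear_apply, Matrix.vecMul_vecMul]

theorem contragredient_apply (x : G) (v : Fin n → ℂ) :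
    contragredient π x v = Matrix.vecMul v (LinearMap.toMatrix' (π x⁻¹)) := rfl

theorem dotProduct_apply (x : G) (w u : Fin n → ℂ) :
    w ⬝ᵥ π x u = contragredient π x⁻¹ w ⬝ᵥ u := by
  rw [contragredient_apply, inv_inv, ← Matrix.dotProduct_mulVec, LinearMap.toMatrix'_mulVec]

variable {π}

/-- The annihilator of an invariant subspace is invariant for `π`, hence trivial, and the dot
product is nondegenerate. -/
theorem isIrreducible_contragredient (h : π.IsIrreducible) :
    (contragredient π).IsIrreducible := by
  have := nontrivial_of_isIrreducible h
  refine isIrreducible_of_eq_bot_or_eq_top fun W hW => ?_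
  let U : Submodule ℂ (Fin n → ℂ) :=
    { carrier := {u | ∀ w ∈ W, w ⬝ᵥ u = 0}
      add_mem' := fun ha hb w hw => by rw [dotProduct_add, ha w hw, hb w hw, add_zero]
      zero_mem' := fun w _ => dotProduct_zero w
      smul_mem' := fun c u hu w hw => by rw [dotProduct_smul, hu w hw, smul_zero] }
  have hU : ∀ u, u ∈ U ↔ ∀ w ∈ W, w ⬝ᵥ u = 0 := fun _ => Iff.rfl
  rcases eq_bot_or_eq_top_of_isIrreducible h U fun g u hu w hw => by
    rw [dotProduct_apply]; exact hu _ (hW _ _ hw) with h0 | h1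
  · right
    by_contra hne
    obtain ⟨f, hf0, hf⟩ := Submodule.exists_le_ker_of_lt_top W (lt_top_iff_ne_top.2 hne)
    have hfu : ∀ w, f w = w ⬝ᵥ fun i => f (Pi.single i 1) := fun w => by
      conv_lhs => rw [← Finset.univ_sum_single w]
      rw [map_sum, dotProduct]
      refine Finset.sum_congr rfl fun i _ => ?_
      rw [← smul_eq_mul, ← map_smul, ← Pi.single_smul, smul_eq_mul, mul_one]
    have hmem : (fun i => f (Pi.single i 1)) ∈ U := fun w hw => by
      rw [← hfu]; exact hf hw
    rw [h0, Submodule.mem_bot] at hmem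
    apply hf0
    ext w
    rw [LinearMap.comp_apply, hfu, hmem]
    simp
  · left
    rw [Submodule.eq_bot_iff]
    intro w hw
    ext i
    have : Pi.single i (1 : ℂ) ∈ U := h1 ▸ Submodule.mem_top
    simpa using this w hw

theorem isTrivial_of_isTrivial_contragredient (h : (contragredient π).IsTrivial) :
    π.IsTrivial where
  out x := by
    apply LinearMap.ext
    intro u
    refine dotProduct_eq _ _ fun w => ?_
    rw [dotProduct_comm, dotProduct_apply, h.out, LinearMap.id_apply, LinearMap.id_apply,
      dotProduct_comm]

variable [TopologicalSpace G]

theorem IsContIrrep.contragredient [ContinuousInv G] (h : IsContIrrep π) :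
    IsContIrrep (contragredient π) where
  irreducible := isIrreducible_contragredient h.irreducible
  continuous v := by
    refine continuous_pi fun j => ?_
    simp only [contragredient_apply, Matrix.vecMul, dotProduct, LinearMap.toMatrix'_apply]
    refine continuous_finsetSum _ fun i _ => continuous_const.mul ?_
    exact (continuous_apply i).comp ((h.continuous _).comp continuous_inv)

theorem IsContIrrep.continuous_character (h : IsContIrrep π) : Continuous π.character := by
  have : π.character = fun x => ∑ i, π x (Pi.single i 1) i := funext (character_eq_sum π)
  rw [this]
  exact continuous_finsetSum _ fun i _ => (continuous_apply i).comp (h.continuous _)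

theorem IsContIrrep.continuous_conj_apply [IsTopologicalGroup G] (h : IsContIrrep π) (x : G) (v : Fin n → ℂ) :
    Continuous fun y => π (y * x * y⁻¹) v :=
  (h.continuous v).comp ((continuous_id.mul continuous_const).mul continuous_inv)

theorem continuous_of_mem_span_irrChars {φ : G → ℂ} (h : φ ∈ Submodule.span ℂ (irrChars G)) :
    Continuous φ := by
  induction h using Submodule.span_induction with
  | mem φ h =>
    obtain ⟨n, π, hπ, rfl⟩ := h
    exact hπ.continuous_character
  | zero => exact continuous_const
  | add φ ψ _ _ hφ hψ => exact hφ.add hψ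
  | smul c φ _ hφ => exact hφ.const_smul c

/-- This brings averaging over the whole group, the projection onto the fixed points, under
hypothesis 2. -/
theorem one_mem_irrChars : (fun _ => 1 : G → ℂ) ∈ irrChars G := by
  refine ⟨1, Representation.trivial ℂ G (Fin 1 → ℂ), ⟨?_, fun v => ?_⟩, ?_⟩
  · exact isIrreducible_of_eq_bot_or_eq_top fun W _ =>
      (isSimpleModule_iff_finrank_eq_one.2 (by simp) :
        IsSimpleModule ℂ (Fin 1 → ℂ)).eq_bot_or_eq_top W
  · simpa using continuous_const
  · ext x
    simp [character_eq_sum]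

end Coordinates

theorem integrable_of_continuous {G : Type*} [TopologicalSpace G] [CompactSpace G]
    [MeasurableSpace G] [BorelSpace G] (μ : Measure G) [IsFiniteMeasureOnCompacts μ]
    {E : Type*} [NormedAddCommGroup E]
    {f : G → E}
    (hf : Continuous f) : Integrable f μ :=
  hf.integrable_of_hasCompactSupport (.of_compactSpace f)

/-! ### Integration of representations of a compact group -/

section CompactGroup

variable {G : Type*} [Group G] [TopologicalSpace G] [IsTopologicalGroup G] [CompactSpace G]
    [MeasurableSpace G] [BorelSpace G] (μ : Measure G) [μ.IsHaarMeasure] [IsProbabilityMeasure μ]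

theorem isMulRightInvariant_of_compactSpace : μ.IsMulRightInvariant where
  map_mul_right_eq_self g := by
    have : IsProbabilityMeasure (μ.map (· * g)) :=
      Measure.isProbabilityMeasure_map (measurable_mul_const g).aemeasurable
    exact Measure.isHaarMeasure_eq_of_isProbabilityMeasure _ _

theorem integral_mul_right {E : Type*} [NormedAddCommGroup E] [NormedSpace ℝ E] (f : G → E)
    (g : G) : ∫ x, f (x * g) ∂μ = ∫ x, f x ∂μ := by
  have := isMulRightInvariant_of_compactSpace μ
  exact integral_mul_right_eq_self f g

theorem integral_conjugate {E : Type*} [NormedAddCommGroup E] [NormedSpace ℝ E] (f : G → E)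
    (g : G) : ∫ x, f (g * x * g⁻¹) ∂μ = ∫ x, f x ∂μ := by
  rw [integral_mul_left_eq_self (fun x => f (x * g⁻¹)) g, integral_mul_right]

variable {n : ℕ} {π : Representation ℂ G (Fin n → ℂ)}

theorem apply_integral (T : (Fin n → ℂ) →ₗ[ℂ] (Fin n → ℂ)) {f : G → Fin n → ℂ}
    (hf : Continuous f) : T (∫ x, f x ∂μ) = ∫ x, T (f x) ∂μ :=
  ((LinearMap.toContinuousLinearMap T).integral_comp_comm (integrable_of_continuous μ hf)).symm

theorem integral_coord {f : G → Fin n → ℂ} (hf : Continuous f) (i : Fin n) :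
    (∫ x, f x ∂μ) i = ∫ x, f x i ∂μ :=
  ((ContinuousLinearMap.proj (R := ℂ) (φ := fun _ : Fin n => ℂ) i).integral_comp_comm
    (integrable_of_continuous μ hf)).symm

/-- The vectors `∫ π(x) v dx` are fixed, and an irreducible nontrivial representation has no nonzero
fixed vector. -/
theorem integral_character_eq_zero (h : IsContIrrep π) (ht : ¬ π.IsTrivial) :
    ∫ x, π.character x ∂μ = 0 := by
  have hfix : ∀ v g, π g (∫ x, π x v ∂μ) = ∫ x, π x v ∂μ := fun v g => by
    rw [apply_integral μ _ (h.continuous v)]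
    simp_rw [← Module.End.mul_apply, ← map_mul]
    exact integral_mul_left_eq_self (fun x => π x v) g
  let W : Submodule ℂ (Fin n → ℂ) :=
    { carrier := {v | ∀ g, π g v = v}
      add_mem' := fun ha hb g => by rw [map_add, ha, hb]
      zero_mem' := fun g => map_zero _
      smul_mem' := fun c v hv g => by rw [map_smul, hv] }
  have hW : W = ⊥ := by
    refine (eq_bot_or_eq_top_of_isIrreducible h.irreducible W fun g v hv => ?_).resolve_right ?_
    · rw [hv g]; exact hv
    · intro htop
      refine ht ⟨fun g => LinearMap.ext fun v => ?_⟩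
      exact (htop ▸ Submodule.mem_top : v ∈ W) g
  have hz : ∀ v, ∫ x, π x v ∂μ = 0 := fun v => by
    have : ∫ x, π x v ∂μ ∈ W := hfix v
    rwa [hW] at this
  simp_rw [character_eq_sum]
  have hc : ∀ i, Continuous fun x => π x (Pi.single i 1) i := fun i =>
    (continuous_apply i).comp (h.continuous _)
  rw [integral_finsetSum _ fun i _ => integrable_of_continuous μ (hc i)]
  refine Finset.sum_eq_zero fun i _ => ?_
  exact (integral_coord μ (h.continuous _) i).symm.trans (congrFun (hz _) i)

/-- The averaged operator commutes with `π`, so it is a scalar by Schur's lemma; its trace is still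
`χ(x)`, which determines the scalar. -/
theorem integral_conj_apply (h : IsContIrrep π) (x : G) (v : Fin n → ℂ) :
    ∫ y, π (y * x * y⁻¹) v ∂μ = (π.character x / n) • v := by
  let T : (Fin n → ℂ) →ₗ[ℂ] (Fin n → ℂ) :=
    { toFun := fun v => ∫ y, π (y * x * y⁻¹) v ∂μ
      map_add' := fun v w => by
        simp only [map_add]
        exact integral_add (integrable_of_continuous μ (h.continuous_conj_apply x v))
          (integrable_of_continuous μ (h.continuous_conj_apply x w))
      map_smul' := fun c v => by
        simp only [map_smul, RingHom.id_apply]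
        exact integral_smul c _ }
  obtain ⟨c, hc⟩ := exists_eq_smul_of_commute h.irreducible T fun g v => by
    change π g (∫ y, π (y * x * y⁻¹) v ∂μ) = ∫ y, π (y * x * y⁻¹) (π g v) ∂μ
    rw [apply_integral μ _ (h.continuous_conj_apply x v),
      ← integral_mul_left_eq_self (fun y => π (y * x * y⁻¹) (π g v)) g]
    simp_rw [← Module.End.mul_apply, ← map_mul]
    congr 1
    ext1 y
    congr 2
    group
  have htr : LinearMap.trace ℂ _ T = π.character x := by
    rw [trace_eq_sum_apply_single]
    have : ∀ i, T (Pi.single i 1) i = ∫ y, π (y * x * y⁻¹) (Pi.single i 1) i ∂μ := fun i =>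
      integral_coord μ (h.continuous_conj_apply x _) i
    simp_rw [this]
    have hcont : ∀ i, Continuous fun y => π (y * x * y⁻¹) (Pi.single i 1) i := fun i =>
      (continuous_apply i).comp (h.continuous_conj_apply x _)
    rw [← integral_finsetSum _ fun i _ => integrable_of_continuous μ (hcont i)]
    simp_rw [← character_eq_sum, Representation.char_conj]
    simp
  have htr' : LinearMap.trace ℂ _ T = c * n := by
    rw [trace_eq_sum_apply_single]
    simp [hc, mul_comm]
  have hn : (n : ℂ) ≠ 0 := by
    have := nontrivial_of_isIrreducible h.irreducible
    rintro h0
    have h0' : n = 0 := by exact_mod_cast h0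
    subst h0'
    exact not_nontrivial _ this
  change T v = _
  rw [hc, ← htr, htr', mul_div_cancel_right₀ _ hn]

end CompactGroup

/-! ### Translation-invariant spaces and characters -/

section Translation

variable {G : Type*} [Group G] [TopologicalSpace G] [IsTopologicalGroup G]

/-- Right translation of continuous functions. -/
noncomputable def rightTranslate : Representation ℂ G C(G, ℂ) where
  toFun g :=
    { toFun := fun f => f.comp (ContinuousMap.mulRight g)
      map_add' := fun _ _ => rfl
      map_smul' := fun _ _ => rfl }
  map_one' := by ext; simp
  map_mul' g h := by ext; simp [mul_assoc]

@[simp]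
theorem rightTranslate_apply (g : G) (f : C(G, ℂ)) (x : G) :
    rightTranslate g f x = f (x * g) := rfl

theorem continuous_rightTranslate (f : C(G, ℂ)) : Continuous fun g : G => rightTranslate g f :=
  (ContinuousMap.curry ⟨fun p : G × G => f (p.2 * p.1), by fun_prop⟩).continuous

end Translation

section PeterWeyl

variable {G : Type*} [Group G] [TopologicalSpace G] [IsTopologicalGroup G] [CompactSpace G]
    [MeasurableSpace G] [BorelSpace G] (μ : Measure G) [μ.IsHaarMeasure] [IsProbabilityMeasure μ]

/-- The average of a function over conjugacy classes. -/
noncomputable def conjAverage : C(G, ℂ) →ₗ[ℂ] (G → ℂ) where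
  toFun f x := ∫ y, f (y * x * y⁻¹) ∂μ
  map_add' f g := funext fun x => integral_add
    (integrable_of_continuous μ (by fun_prop)) (integrable_of_continuous μ (by fun_prop))
  map_smul' c f := funext fun x => integral_smul c _

theorem conjAverage_apply (f : C(G, ℂ)) (x : G) :
    conjAverage μ f x = ∫ y, f (y * x * y⁻¹) ∂μ := rfl

/-- The inclusion of the continuous functions into `L²`. -/
noncomputable abbrev toL2 : C(G, ℂ) →L[ℂ] Lp ℂ 2 μ := ContinuousMap.toLp 2 μ ℂ

theorem toL2_injective : Function.Injective (toL2 μ) := ContinuousMap.toLp_injective μ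

theorem inner_toL2 (f g : C(G, ℂ)) :
    inner ℂ (toL2 μ f) (toL2 μ g) = ∫ x, g x * (starRingEnd ℂ) (f x) ∂μ :=
  ContinuousMap.inner_toLp μ f g

theorem inner_toL2_rightTranslate (f h : C(G, ℂ)) (g : G) :
    inner ℂ (toL2 μ f) (toL2 μ (rightTranslate g h)) =
      inner ℂ (toL2 μ (rightTranslate g⁻¹ f)) (toL2 μ h) := by
  rw [inner_toL2, inner_toL2,
    ← integral_mul_right μ (fun x => h x * (starRingEnd ℂ) (rightTranslate g⁻¹ f x)) g]
  simp

/-- Here `f(x) = ξ(π(x) f)` with `ξ` evaluation at the identity, so averaging `π` over conjugates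
gives `(f(1) / n) χ_π`. -/
theorem conjAverage_mem_span_of_irreducible (V : Submodule ℂ C(G, ℂ)) [FiniteDimensional ℂ V]
    (hV : ∀ g, ∀ f ∈ V, rightTranslate g f ∈ V)
    (hirr : ∀ W : Submodule ℂ C(G, ℂ), W ≤ V → (∀ g, ∀ f ∈ W, rightTranslate g f ∈ W) →
      W = ⊥ ∨ W = V) {f : C(G, ℂ)} (hf : f ∈ V) :
    conjAverage μ f ∈ Submodule.span ℂ (irrChars G) := by
  rcases eq_or_ne f 0 with rfl | hf0
  · rw [map_zero]; exact zero_mem _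
  have : Nontrivial V := ⟨⟨⟨f, hf⟩, 0, fun h => hf0 (congrArg Subtype.val h)⟩⟩
  let n := Module.finrank ℂ V
  let e : V ≃ₗ[ℂ] (Fin n → ℂ) := (Module.finBasis ℂ V).equivFun
  have : Nontrivial (Fin n → ℂ) := e.symm.nontrivial
  let ρ : Representation ℂ G V :=
    { toFun := fun g => (rightTranslate g).restrict (hV g)
      map_one' := by ext; simp
      map_mul' := fun x y => by ext; simp [mul_assoc] }
  let π : Representation ℂ G (Fin n → ℂ) :=
    { toFun := fun g => e.conj (ρ g)
      map_one' := by rw [map_one]; ext; simp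
      map_mul' := fun x y => by rw [map_mul]; ext; simp [LinearEquiv.conj_apply] }
  have hπ : ∀ g v, π g v = e (ρ g (e.symm v)) := fun g v => rfl
  have hρ : ∀ g (v : V), ((ρ g v : V) : C(G, ℂ)) = rightTranslate g v := fun g v => rfl
  have hc : IsContIrrep π := by
    refine ⟨isIrreducible_of_eq_bot_or_eq_top fun W hW => ?_, fun v => ?_⟩
    · let W' : Submodule ℂ C(G, ℂ) := (W.comap e.toLinearMap).map V.subtype
      have hmem : ∀ w : V, (w : C(G, ℂ)) ∈ W' ↔ e w ∈ W := fun w => by simp [W']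
      have hW' : ∀ g, ∀ f ∈ W', rightTranslate g f ∈ W' := by
        rintro g _ ⟨w, hw, rfl⟩
        have : e (ρ g w) ∈ W := by
          have h := hW g _ hw
          rw [hπ] at h
          simpa using h
        exact (hmem _).2 this
      rcases hirr W' (Submodule.map_subtype_le _ _) hW' with h0 | h1
      · left
        rw [Submodule.eq_bot_iff]
        intro v hv
        have h : ((e.symm v : V) : C(G, ℂ)) ∈ W' := (hmem _).2 (by simpa using hv)
        rw [h0, Submodule.mem_bot] at h
        simpa using h
      · right
        rw [Submodule.eq_top_iff']
        intro v
        have h : ((e.symm v : V) : C(G, ℂ)) ∈ W' :=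
          h1.ge (e.symm v).2
        simpa using (hmem _).1 h
    · have h1 : Continuous fun g => ρ g (e.symm v) :=
        continuous_induced_rng.2 (continuous_rightTranslate _)
      exact (LinearMap.continuous_of_finiteDimensional e.toLinearMap).comp h1
  let ξ : (Fin n → ℂ) →ₗ[ℂ] ℂ :=
    { toFun := fun v => (e.symm v : C(G, ℂ)) 1
      map_add' := fun v w => by simp
      map_smul' := fun c v => by simp }
  have hfx : ∀ x, f x = ξ (π x (e ⟨f, hf⟩)) := fun x => by
    change f x = (e.symm (e (ρ x (e.symm (e ⟨f, hf⟩)))) : C(G, ℂ)) 1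
    rw [e.symm_apply_apply, e.symm_apply_apply, hρ]
    simp
  have key : conjAverage μ f = (f 1 / n) • π.character := by
    ext x
    rw [conjAverage_apply]
    simp_rw [hfx (_ * x * _)]
    have h1 := (LinearMap.toContinuousLinearMap ξ).integral_comp_comm
      (integrable_of_continuous μ (hc.continuous_conj_apply x (e ⟨f, hf⟩)))
    rw [integral_conj_apply μ hc] at h1
    refine h1.trans ?_
    rw [map_smul, Pi.smul_apply, smul_eq_mul, smul_eq_mul]
    have h2 : LinearMap.toContinuousLinearMap ξ (e ⟨f, hf⟩) = f 1 := by
      rw [hfx 1, map_one]; rfl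
    rw [h2]
    ring
  rw [key]
  exact Submodule.smul_mem _ _ (Submodule.subset_span ⟨n, π, hc, rfl⟩)

/-- Complete reducibility by induction on the dimension: right translation preserves the `L²` inner
product, so an invariant subspace has an invariant orthogonal complement in `V`. -/
theorem conjAverage_mem_span_of_invariant (V : Submodule ℂ C(G, ℂ)) [FiniteDimensional ℂ V]
    (hV : ∀ g, ∀ f ∈ V, rightTranslate g f ∈ V) {f : C(G, ℂ)} (hf : f ∈ V) :
    conjAverage μ f ∈ Submodule.span ℂ (irrChars G) := by
  induction hd : Module.finrank ℂ V using Nat.strong_induction_on generalizing V f with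
  | _ d ih =>
    subst hd
    by_cases hirr : ∀ W : Submodule ℂ C(G, ℂ), W ≤ V →
        (∀ g, ∀ f ∈ W, rightTranslate g f ∈ W) → W = ⊥ ∨ W = V
    · exact conjAverage_mem_span_of_irreducible μ V hV hirr hf
    push Not at hirr
    obtain ⟨W, hWV, hW, hW0, hWne⟩ := hirr
    have : FiniteDimensional ℂ W := Submodule.finiteDimensional_of_le hWV
    let j : C(G, ℂ) →ₗ[ℂ] Lp ℂ 2 μ := (toL2 μ).toLinearMap
    let U : Submodule ℂ C(G, ℂ) := V ⊓ (W.map j)ᗮ.comap j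
    have hUmem : ∀ h, h ∈ U ↔ h ∈ V ∧ ∀ w ∈ W, inner ℂ (toL2 μ w) (toL2 μ h) = 0 := fun h => by
      simp [U, Submodule.mem_orthogonal, j]
    have hU : ∀ g, ∀ f ∈ U, rightTranslate g f ∈ U := fun g h hh => by
      rw [hUmem] at hh ⊢
      refine ⟨hV g h hh.1, fun w hw => ?_⟩
      rw [inner_toL2_rightTranslate]
      exact hh.2 _ (hW _ _ hw)
    have hUV : U < V := by
      refine lt_of_le_of_ne inf_le_left fun h => hW0 ?_
      rw [Submodule.eq_bot_iff]
      intro w hw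
      have hwU : w ∈ U := h ▸ hWV hw
      have := ((hUmem w).1 hwU).2 w hw
      rw [inner_self_eq_zero] at this
      exact toL2_injective μ (this.trans (map_zero _).symm)
    have : FiniteDimensional ℂ U := Submodule.finiteDimensional_of_le hUV.le
    obtain ⟨_, ⟨w, hw, rfl⟩, z, hz, hwz⟩ :=
      Submodule.exists_add_mem_mem_orthogonal (K := W.map j) (toL2 μ f)
    have hz' : f - w ∈ U := by
      refine ⟨V.sub_mem hf (hWV hw), ?_⟩
      change j (f - w) ∈ (W.map j)ᗮ
      have : j (f - w) = z := by
        rw [map_sub, sub_eq_iff_eq_add']; exact hwz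
      rw [this]
      exact hz
    have e : f = w + (f - w) := by abel
    rw [e, map_add]
    exact add_mem
      (ih _ (Submodule.finrank_lt_finrank_of_lt (lt_of_le_of_ne hWV hWne)) W hW hw rfl)
      (ih _ (Submodule.finrank_lt_finrank_of_lt hUV) U hU hz' rfl)

end PeterWeyl

/-! ### Convolution operators and their eigenfunctions -/

section Convolution

variable {G : Type*} [Group G] [TopologicalSpace G] [IsTopologicalGroup G] [CompactSpace G]
    [MeasurableSpace G] [BorelSpace G] (μ : Measure G) [μ.IsHaarMeasure] [IsProbabilityMeasure μ]

/-- The kernel `y ↦ k (x y⁻¹)` of the convolution operator, as a continuous family in `x`. -/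
noncomputable def convKernel (k : C(G, ℂ)) : C(G, C(G, ℂ)) :=
  ContinuousMap.curry ⟨fun p : G × G => k (p.1 * p.2⁻¹), by fun_prop⟩

theorem convKernel_apply (k : C(G, ℂ)) (x y : G) : convKernel k x y = k (x * y⁻¹) := rfl

/-- The convolution operator `f ↦ (x ↦ ∫ conj (k (x y⁻¹)) f(y) dy)`. -/
noncomputable def convolution (k : C(G, ℂ)) : Lp ℂ 2 μ →L[ℂ] C(G, ℂ) :=
  LinearMap.mkContinuous
    { toFun := fun f => ⟨fun x => inner ℂ (toL2 μ (convKernel k x)) f,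
        ((toL2 μ).continuous.comp (convKernel k).continuous).inner continuous_const⟩
      map_add' := fun f g => by
        ext x; exact inner_add_right (𝕜 := ℂ) (toL2 μ (convKernel k x)) f g
      map_smul' := fun c f => by
        ext x; exact inner_smul_right (𝕜 := ℂ) (toL2 μ (convKernel k x)) f c }
    (‖(toL2 μ)‖ * ‖k‖) fun f => by
      refine (ContinuousMap.norm_le _ (by positivity)).2 fun x => ?_
      refine (norm_inner_le_norm (𝕜 := ℂ) (toL2 μ (convKernel k x)) f).trans ?_
      gcongr
      refine ((toL2 μ).le_opNorm _).trans ?_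
      gcongr
      exact (ContinuousMap.norm_le _ (norm_nonneg _)).2 fun y => k.norm_coe_le_norm _

theorem convolution_apply (k : C(G, ℂ)) (f : Lp ℂ 2 μ) (x : G) :
    convolution μ k f x = inner ℂ (toL2 μ (convKernel k x)) f := rfl

theorem convolution_toL2_apply (k f : C(G, ℂ)) (x : G) :
    convolution μ k (toL2 μ f) x = ∫ y, f y * (starRingEnd ℂ) (k (x * y⁻¹)) ∂μ := by
  rw [convolution_apply, inner_toL2]
  rfl

/-- The image of the unit ball is equicontinuous because `x ↦ k(x ·⁻¹)` is continuous into `L²`. -/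
theorem isCompactOperator_convolution (k : C(G, ℂ)) : IsCompactOperator (convolution μ k) := by
  have h := isCompactOperator_iff_isCompact_closure_image_closedBall
    (convolution μ k).toLinearMap one_pos
  refine h.2 ?_
  refine TotallyBounded.isCompact_of_isClosed (TotallyBounded.closure ?_) isClosed_closure
  refine totallyBounded_of_equicontinuous (M := ‖convolution μ k‖) ?_ ?_
  · rintro _ ⟨f, hf, rfl⟩ x
    refine (ContinuousMap.norm_coe_le_norm _ x).trans (((convolution μ k).le_opNorm f).trans ?_)
    exact mul_le_of_le_one_right (norm_nonneg _) (mem_closedBall_zero_iff.1 hf)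
  · intro x
    rw [Metric.equicontinuousAt_iff_right]
    intro ε hε
    have hc : Continuous fun x => toL2 μ (convKernel k x) :=
      (toL2 μ).continuous.comp (convKernel k).continuous
    filter_upwards [Metric.continuousAt_iff'.1 hc.continuousAt ε hε] with y hy
    rintro ⟨_, f, hf, rfl⟩
    change dist (inner ℂ (toL2 μ (convKernel k x)) f) (inner ℂ (toL2 μ (convKernel k y)) f) < ε
    rw [dist_eq_norm, ← inner_sub_left]
    refine (norm_inner_le_norm _ _).trans_lt ?_
    refine (mul_le_of_le_one_right (norm_nonneg _) (mem_closedBall_zero_iff.1 hf)).trans_lt ?_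
    rwa [← dist_eq_norm, dist_comm]

/-- The convolution operator on `L²`. -/
noncomputable def convolutionL2 (k : C(G, ℂ)) : Lp ℂ 2 μ →L[ℂ] Lp ℂ 2 μ :=
  toL2 μ ∘L convolution μ k

theorem isCompactOperator_convolutionL2 (k : C(G, ℂ)) :
    IsCompactOperator (convolutionL2 μ k) :=
  (isCompactOperator_convolution μ k).clm_comp (toL2 μ)

/-- Needed for the continuous eigenfunctions of the convolution operator to form
translation-invariant spaces. -/
theorem convolution_rightTranslate (k f : C(G, ℂ)) (g : G) :
    convolution μ k (toL2 μ (rightTranslate g f)) =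
      rightTranslate g (convolution μ k (toL2 μ f)) := by
  ext x
  rw [rightTranslate_apply, convolution_toL2_apply, convolution_toL2_apply,
    ← integral_mul_right μ (fun y => f y * (starRingEnd ℂ) (k (x * g * y⁻¹))) g]
  simp [mul_assoc]

variable [T2Space G]

theorem isSymmetric_convolutionL2 {k : C(G, ℂ)} (hk : ∀ x, (starRingEnd ℂ) (k x) = k x)
    (hk' : ∀ x, k x⁻¹ = k x) : (convolutionL2 μ k).IsSymmetric := by
  have hd : DenseRange (toL2 μ) := ContinuousMap.toLp_denseRange ℂ μ ℂ (by simp)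
  intro f g
  refine hd.induction_on₂ (p := fun f g => inner ℂ (convolutionL2 μ k f) g =
    inner ℂ f (convolutionL2 μ k g)) ?_ ?_ f g
  · exact isClosed_eq (by fun_prop) (by fun_prop)
  · intro a b
    change inner ℂ (toL2 μ (convolution μ k (toL2 μ a))) (toL2 μ b) =
      inner ℂ (toL2 μ a) (toL2 μ (convolution μ k (toL2 μ b)))
    rw [inner_toL2, inner_toL2]
    simp_rw [convolution_toL2_apply, ← _root_.integral_conj, ← integral_const_mul, ← integral_mul_const]
    rw [integral_integral_swap_of_hasCompactSupport (by
      simp only [Function.uncurry_def]; fun_prop) (.of_compactSpace _)]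
    congr 1
    ext x
    congr 1
    ext y
    have : k (y * x⁻¹) = k (x * y⁻¹) := by rw [← hk']; simp
    simp only [map_mul, hk, this]
    ring

/-- The spectral theorem for the compact symmetric convolution by `k`: the function `k` itself lies
in the closed span of the eigenspaces with nonzero eigenvalue. -/
theorem exists_conjAverage_mem_span_near {k : C(G, ℂ)} (hk : ∀ x, (starRingEnd ℂ) (k x) = k x)
    (hk' : ∀ x, k x⁻¹ = k x) {ε : ℝ} (hε : 0 < ε) :
    ∃ h : C(G, ℂ), conjAverage μ h ∈ Submodule.span ℂ (irrChars G) ∧ ‖toL2 μ (h - k)‖ < ε := by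
  set T := convolutionL2 μ k with hT
  have hTc : IsCompactOperator T := isCompactOperator_convolutionL2 μ k
  have hTs : T.IsSymmetric := isSymmetric_convolutionL2 μ hk hk'
  have hT' : ∀ f, T f = toL2 μ (convolution μ k f) := fun f => rfl
  let Y : Submodule ℂ C(G, ℂ) := (Submodule.span ℂ (irrChars G)).comap (conjAverage μ)
  let E : ℂ → Submodule ℂ (Lp ℂ 2 μ) := fun c => Module.End.eigenspace T.toLinearMap c
  have hE : ∀ c f, f ∈ E c ↔ T f = c • f := fun c f => Module.End.mem_eigenspace_iff
  let U : Submodule ℂ (Lp ℂ 2 μ) := ⨆ c : {c : ℂ // c ≠ 0}, E c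
  -- An eigenvector with `c ≠ 0` has the continuous representative `c⁻¹ (k * f)`, which lies in a
  -- finite-dimensional translation-invariant space.
  have hEY : ∀ c : ℂ, c ≠ 0 → E c ≤ Y.map (toL2 μ).toLinearMap := by
    intro c hc f hf
    have hfT : toL2 μ (c⁻¹ • convolution μ k f) = f := by
      rw [map_smul, ← hT', (hE c f).1 hf, inv_smul_smul₀ hc]
    refine ⟨c⁻¹ • convolution μ k f, ?_, hfT⟩
    let V : Submodule ℂ C(G, ℂ) := (E c).comap (toL2 μ).toLinearMap
    have hVmem : ∀ h, h ∈ V ↔ convolution μ k (toL2 μ h) = c • h := fun h => by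
      change toL2 μ h ∈ E c ↔ _
      rw [hE, hT', ← map_smul]
      exact (toL2_injective μ).eq_iff
    have hfin : FiniteDimensional ℂ (E c) :=
      ContinuousLinearMap.finite_dimensional_eigenspace hTc c hc
    let r : V →ₗ[ℂ] E c := (toL2 μ).toLinearMap.restrict fun _ hx => hx
    have : FiniteDimensional ℂ V := FiniteDimensional.of_injective r fun a b hab =>
      Subtype.ext (toL2_injective μ (congrArg Subtype.val hab))
    refine conjAverage_mem_span_of_invariant μ V (fun g h hh => ?_) (?_ : _ ∈ V)
    · rw [hVmem] at hh ⊢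
      rw [convolution_rightTranslate, hh, map_smul]
    · change toL2 μ _ ∈ E c
      rw [hfT]
      exact hf
  have hUY : U ≤ Y.map (toL2 μ).toLinearMap := iSup_le fun c => hEY c c.2
  -- `T v` is orthogonal to every eigenspace, including that of 0, by symmetry; the eigenspaces span
  -- a dense subspace.
  have hker : ∀ v ∈ Uᗮ, T v = 0 := by
    intro v hv
    have : T v ∈ (⨆ c, E c)ᗮ := by
      rw [Submodule.mem_orthogonal]
      intro u hu
      induction hu using Submodule.iSup_induction' with
      | mem c u hu =>
        have hs : inner ℂ u (T v) = inner ℂ (T u) v := (hTs u v).symm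
        rw [hs, (hE c u).1 hu, inner_smul_left]
        rcases eq_or_ne c 0 with rfl | hc
        · simp
        · have hmem : u ∈ U := Submodule.mem_iSup_of_mem (⟨c, hc⟩ : {c : ℂ // c ≠ 0}) hu
          rw [(Submodule.mem_orthogonal _ _).1 hv u hmem, mul_zero]
      | zero => exact inner_zero_left _
      | add x y _ _ hx hy => rw [inner_add_left, hx, hy, add_zero]
    rwa [ContinuousLinearMap.orthogonalComplement_iSup_eigenspaces_eq_bot hTc hTs,
      Submodule.mem_bot] at this
  have hkU : toL2 μ k ∈ U.topologicalClosure := by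
    rw [← Submodule.orthogonal_orthogonal_eq_closure, Submodule.mem_orthogonal']
    intro v hv
    -- The convolution vanishes as a continuous function, so it can be evaluated at the identity,
    -- where its value is `⟨k, v⟩`.
    have h0 : convolution μ k v = 0 :=
      toL2_injective μ ((hker v hv).trans (map_zero _).symm)
    have h1 : convKernel k 1 = k := by
      ext y
      rw [convKernel_apply, one_mul, hk']
    rw [← h1, ← convolution_apply, h0]
    rfl
  obtain ⟨u, hu, hku⟩ := Metric.mem_closure_iff.1 hkU ε hε
  obtain ⟨h, hh, rfl⟩ := hUY hu
  refine ⟨h, hh, ?_⟩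
  rw [map_sub, ← dist_eq_norm, dist_comm]
  exact hku

theorem norm_toL2_sq (f : C(G, ℂ)) :
    ((‖toL2 μ f‖ ^ 2 : ℝ) : ℂ) = ∫ x, f x * (starRingEnd ℂ) (f x) ∂μ := by
  have h := inner_self_eq_norm_sq_to_K (𝕜 := ℂ) (toL2 μ f)
  rw [inner_toL2] at h
  exact_mod_cast h.symm

/-- Cauchy–Schwarz against the constant 1, which has norm 1 for a probability measure. -/
theorem integral_norm_le_norm_toL2 (f : C(G, ℂ)) : ∫ x, ‖f x‖ ∂μ ≤ ‖toL2 μ f‖ := by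
  let g : C(G, ℂ) := ⟨fun x => (‖f x‖ : ℂ), by fun_prop⟩
  have hg : ‖toL2 μ g‖ = ‖toL2 μ f‖ := by
    rw [← sq_eq_sq₀ (norm_nonneg _) (norm_nonneg _)]
    have : ((‖toL2 μ g‖ ^ 2 : ℝ) : ℂ) = ((‖toL2 μ f‖ ^ 2 : ℝ) : ℂ) := by
      rw [norm_toL2_sq, norm_toL2_sq]
      congr 1
      ext x
      simp [g, Complex.mul_conj, Complex.normSq_eq_norm_sq, sq]
    exact_mod_cast this
  have h1 : ‖toL2 μ (1 : C(G, ℂ))‖ = 1 := by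
    rw [← sq_eq_sq₀ (norm_nonneg _) zero_le_one]
    have : ((‖toL2 μ (1 : C(G, ℂ))‖ ^ 2 : ℝ) : ℂ) = 1 := by
      rw [norm_toL2_sq]
      simp
    rw [one_pow]
    exact_mod_cast this
  have h := norm_inner_le_norm (𝕜 := ℂ) (toL2 μ (1 : C(G, ℂ))) (toL2 μ g)
  rw [inner_toL2, h1, one_mul, hg] at h
  refine le_trans (le_of_eq ?_) h
  simp only [g, ContinuousMap.one_apply, map_one, mul_one, ContinuousMap.coe_mk]
  rw [integral_complex_ofReal, Complex.norm_real, Real.norm_of_nonneg]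
  exact integral_nonneg fun x => norm_nonneg _

end Convolution

/-! ### Length functions and concentrated combinations of characters -/

namespace IsLengthFunction

variable {G : Type*} [Group G] [TopologicalSpace G] {l : G → ℝ}

theorem map_one (hl : IsLengthFunction l) : l 1 = 0 := (hl.eq_zero_iff 1).2 rfl

theorem nonneg (hl : IsLengthFunction l) (x : G) : 0 ≤ l x := by
  have := hl.mul_le x x⁻¹
  rw [mul_inv_cancel, hl.map_one, hl.inv_eq] at this
  linarith

theorem pos (hl : IsLengthFunction l) {x : G} (hx : x ≠ 1) : 0 < l x :=
  lt_of_le_of_ne (hl.nonneg x) fun h => hx ((hl.eq_zero_iff x).1 h.symm)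

theorem t2Space [IsTopologicalGroup G] (hl : IsLengthFunction l) : T2Space G := by
  refine IsTopologicalGroup.t2Space_of_one_sep fun x hx => ⟨{y | l y < l x}, ?_, by simp⟩
  exact hl.continuous.continuousAt.eventually (gt_mem_nhds (by rw [hl.map_one]; exact hl.pos hx))

/-- A substitute for conjugation invariance of `l`: on the compact set of pairs with `l(y⁻¹ x y) ≥
ε`, the minimum of `l(x)` is positive and serves as `δ`. -/
theorem exists_forall_conj_lt [IsTopologicalGroup G] [CompactSpace G] (hl : IsLengthFunction l)
    {ε : ℝ} (hε : 0 < ε) : ∃ δ > 0, ∀ x, l x < δ → ∀ y, l (y⁻¹ * x * y) < ε := by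
  let s : Set (G × G) := {p | ε ≤ l (p.2⁻¹ * p.1 * p.2)}
  have hlc := hl.continuous
  have hs : IsCompact s := (isClosed_le continuous_const (by fun_prop)).isCompact
  rcases s.eq_empty_or_nonempty with h0 | hne
  · refine ⟨1, one_pos, fun x _ y => ?_⟩
    by_contra hlt
    exact h0.subset (show (x, y) ∈ s from not_lt.1 hlt)
  · obtain ⟨p, hp, hmin⟩ := hs.exists_isMinOn (f := fun p => l p.1) hne (by fun_prop)
    refine ⟨l p.1, hl.pos fun h1 => ?_, fun x hx y => ?_⟩
    · have hp' : ε ≤ l (p.2⁻¹ * p.1 * p.2) := hp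
      rw [h1, mul_one, inv_mul_cancel, hl.map_one] at hp'
      linarith
    · by_contra hlt
      exact absurd (hmin (show (x, y) ∈ s from not_lt.1 hlt)) (not_le.2 hx)

end IsLengthFunction

section ApproximateIdentity

variable {G : Type*} [Group G] [TopologicalSpace G] [IsTopologicalGroup G] [CompactSpace G]
    [MeasurableSpace G] [BorelSpace G] (μ : Measure G) [μ.IsHaarMeasure] [IsProbabilityMeasure μ]

theorem integral_conjAverage (h : C(G, ℂ)) : ∫ x, conjAverage μ h x ∂μ = ∫ x, h x ∂μ := by
  simp_rw [conjAverage_apply]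
  rw [integral_integral_swap_of_hasCompactSupport (by
      simp only [Function.uncurry_def]; fun_prop) (.of_compactSpace _)]
  simp_rw [integral_conjugate μ (fun x => h x)]
  simp

theorem continuous_integral_continuousMap : Continuous fun f : C(G, ℝ) => ∫ x, f x ∂μ := by
  refine (LipschitzWith.of_dist_le_mul (K := 1) fun f g => ?_).continuous
  rw [dist_eq_norm, NNReal.coe_one, one_mul,
    ← integral_sub (integrable_of_continuous μ (map_continuous f))
      (integrable_of_continuous μ (map_continuous g))]
  refine (norm_integral_le_of_norm_le_const (C := dist f g) (.of_forall fun x => ?_)).trans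
    (by simp)
  rw [← dist_eq_norm]
  exact ContinuousMap.dist_apply_le_dist x

/-- Fubini and invariance under conjugation move the average from `h` onto the weight. -/
theorem integral_norm_conjAverage_mul_le (h : C(G, ℂ)) {w : G → ℝ} (hw : Continuous w)
    (hw0 : ∀ x, 0 ≤ w x) {c : ℝ}
    (hc : ∀ y, ∫ x, ‖h x‖ * w (y⁻¹ * x * y) ∂μ ≤ c) :
    ∫ x, ‖conjAverage μ h x‖ * w x ∂μ ≤ c := by
  have hu : Continuous (Function.uncurry fun x y => ‖h (y * x * y⁻¹)‖ * w x) := by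
    simp only [Function.uncurry_def]; fun_prop
  have hcs := HasCompactSupport.of_compactSpace (Function.uncurry fun x y => ‖h (y * x * y⁻¹)‖ * w x)
  calc ∫ x, ‖conjAverage μ h x‖ * w x ∂μ
      ≤ ∫ x, ∫ y, ‖h (y * x * y⁻¹)‖ * w x ∂μ ∂μ := by
        refine integral_mono_of_nonneg (.of_forall fun x => mul_nonneg (norm_nonneg _) (hw0 x))
          ?_ (.of_forall fun x => ?_)
        · have hi : Continuous fun x => ∫ y, ‖h (y * x * y⁻¹)‖ * w x ∂μ := by
            exact (continuous_integral_continuousMap μ).comp (ContinuousMap.curry ⟨_, hu⟩).continuous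
          exact integrable_of_continuous μ hi
        · change ‖conjAverage μ h x‖ * w x ≤ ∫ y, ‖h (y * x * y⁻¹)‖ * w x ∂μ
          rw [integral_mul_const]
          exact mul_le_mul_of_nonneg_right (norm_integral_le_integral_norm _) (hw0 x)
    _ = ∫ y, ∫ x, ‖h (y * x * y⁻¹)‖ * w x ∂μ ∂μ :=
        integral_integral_swap_of_hasCompactSupport hu hcs
    _ = ∫ y, ∫ x, ‖h x‖ * w (y⁻¹ * x * y) ∂μ ∂μ := by
        congr 1
        ext y
        rw [← integral_conjugate μ (fun x => ‖h x‖ * w (y⁻¹ * x * y)) y]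
        congr 1
        ext x
        congr 2
        group
    _ ≤ ∫ _, c ∂μ := by
        refine integral_mono_of_nonneg (.of_forall fun y => integral_nonneg fun x =>
          mul_nonneg (norm_nonneg _) (hw0 _)) (integrable_const c) (.of_forall hc)
    _ = c := by simp

theorem exists_mem_span_irrChars_concentrated {l : G → ℝ} (hl : IsLengthFunction l)
    {ε : ℝ} (hε : 0 < ε) :
    ∃ φ ∈ Submodule.span ℂ (irrChars G), ∫ x, φ x ∂μ = 1 ∧ ∫ x, ‖φ x‖ * l x ∂μ < ε := by
  have := hl.t2Space
  have hlc := hl.continuous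
  obtain ⟨M, hM0, hM⟩ : ∃ M : ℝ, 0 < M ∧ ∀ x, l x ≤ M := by
    obtain ⟨M, hM⟩ := (isCompact_range hlc).bddAbove
    exact ⟨max M 1, by positivity, fun x => (hM ⟨x, rfl⟩).trans (le_max_left _ _)⟩
  obtain ⟨δ, hδ, hδl⟩ := hl.exists_forall_conj_lt (ε := ε / 8) (by positivity)
  let b : G → ℝ := fun x => max 0 (δ - l x)
  have hb0 : ∀ x, 0 ≤ b x := fun x => le_max_left _ _
  have hbc : Continuous b := by fun_prop
  have hZ : 0 < ∫ x, b x ∂μ := by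
    refine hbc.integral_pos_of_hasCompactSupport_nonneg_nonzero (.of_compactSpace _) hb0
      (x := 1) ?_
    simp only [b, hl.map_one, sub_zero]
    exact (lt_max_of_lt_right hδ).ne'
  set Z := ∫ x, b x ∂μ
  let r : G → ℝ := fun x => b x / Z
  have hr0 : ∀ x, 0 ≤ r x := fun x => div_nonneg (hb0 x) hZ.le
  have hrc : Continuous r := by fun_prop
  have hr1 : ∫ x, r x ∂μ = 1 := by
    simp only [r]
    rw [integral_div, div_self hZ.ne']
  let k : C(G, ℂ) := ⟨fun x => (r x : ℂ), by fun_prop⟩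
  have hkr : ∀ x, k x = (r x : ℂ) := fun x => rfl
  -- The bound `1/2` keeps `‖c‖ ≥ 1/2`, so normalising costs a factor of at most 2; the other bound
  -- gives `M η ≤ ε/8`. The total is at most `2 (ε/8 + ε/8) < ε`.
  set η : ℝ := min (1 / 2) (ε / (8 * M))
  have hη : 0 < η := by positivity
  obtain ⟨h, hh, hhk⟩ := exists_conjAverage_mem_span_near μ (k := k)
    (fun x => Complex.conj_ofReal _) (fun x => by simp only [hkr, r, b, hl.inv_eq]) hη
  have hd : ∫ x, ‖(h - k) x‖ ∂μ ≤ η := (integral_norm_le_norm_toL2 μ _).trans hhk.le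
  have hkint : ∫ x, k x ∂μ = 1 := by
    simp_rw [hkr]
    rw [integral_complex_ofReal, hr1, Complex.ofReal_one]
  set c := ∫ x, h x ∂μ with hcdef
  have hc1 : ‖c - 1‖ ≤ η := by
    rw [hcdef, ← hkint, ← integral_sub (integrable_of_continuous μ (map_continuous h))
      (integrable_of_continuous μ (map_continuous k))]
    exact (norm_integral_le_integral_norm _).trans hd
  have hc : 1 / 2 ≤ ‖c‖ := by
    have h1 := norm_sub_norm_le 1 c
    rw [norm_one, norm_sub_rev] at h1
    have h2 : η ≤ 1 / 2 := min_le_left _ _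
    linarith
  have hc0 : c ≠ 0 := fun h0 => by
    rw [h0, norm_zero] at hc
    linarith
  have hbound : ∫ x, ‖conjAverage μ h x‖ * l x ∂μ ≤ ε / 8 + M * η := by
    refine integral_norm_conjAverage_mul_le μ h hlc hl.nonneg fun y => ?_
    calc ∫ x, ‖h x‖ * l (y⁻¹ * x * y) ∂μ
        ≤ ∫ x, (r x * (ε / 8) + M * ‖(h - k) x‖) ∂μ := by
          refine integral_mono (integrable_of_continuous μ (by fun_prop))
            (integrable_of_continuous μ (by fun_prop)) fun x => ?_
          have h1 : ‖h x‖ ≤ r x + ‖(h - k) x‖ := by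
            have e : h x = (r x : ℂ) + (h - k) x := by
              rw [ContinuousMap.sub_apply, hkr]; ring
            conv_lhs => rw [e]
            refine (norm_add_le _ _).trans (add_le_add_left (le_of_eq ?_) _)
            rw [Complex.norm_real, Real.norm_of_nonneg (hr0 x)]
          have h2 : r x * l (y⁻¹ * x * y) ≤ r x * (ε / 8) := by
            by_cases hx : l x < δ
            · exact mul_le_mul_of_nonneg_left (hδl x hx y).le (hr0 x)
            · have : r x = 0 := by
                simp only [r, b]
                rw [max_eq_left (by linarith), zero_div]
              simp [this]
          calc ‖h x‖ * l (y⁻¹ * x * y) ≤ (r x + ‖(h - k) x‖) * l (y⁻¹ * x * y) :=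
                mul_le_mul_of_nonneg_right h1 (hl.nonneg _)
            _ = r x * l (y⁻¹ * x * y) + l (y⁻¹ * x * y) * ‖(h - k) x‖ := by ring
            _ ≤ _ := add_le_add h2 (mul_le_mul_of_nonneg_right (hM _) (norm_nonneg _))
      _ = ε / 8 + M * ∫ x, ‖(h - k) x‖ ∂μ := by
          rw [integral_add (integrable_of_continuous μ (by fun_prop))
            (integrable_of_continuous μ (by fun_prop)), integral_mul_const, hr1, one_mul,
            integral_const_mul]
      _ ≤ _ := by gcongr
  refine ⟨c⁻¹ • conjAverage μ h, Submodule.smul_mem _ _ hh, ?_, ?_⟩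
  · simp only [Pi.smul_apply, smul_eq_mul]
    rw [integral_const_mul, integral_conjAverage, inv_mul_cancel₀ hc0]
  · simp only [Pi.smul_apply, norm_smul, norm_inv, mul_assoc]
    rw [integral_const_mul]
    have hMη : M * η ≤ ε / 8 := by
      calc M * η ≤ M * (ε / (8 * M)) := by gcongr; exact min_le_right _ _
        _ = ε / 8 := by field_simp
    have hcinv : ‖c‖⁻¹ ≤ 2 := by
      rw [inv_le_comm₀ (by linarith) two_pos]
      linarith
    calc ‖c‖⁻¹ * ∫ x, ‖conjAverage μ h x‖ * l x ∂μ ≤ 2 * (ε / 8 + M * η) := by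
          refine mul_le_mul hcinv hbound (integral_nonneg fun x =>
            mul_nonneg (norm_nonneg _) (hl.nonneg x)) two_pos.le
      _ < ε := by linarith

end ApproximateIdentity

/-! ### Averages along the action and isotypic components -/

section Action

variable {G : Type*} [Group G] {A : Type*} [CStarAlgebra A] (α : G →* (A ≃⋆ₐ[ℂ] A))

theorem norm_action_apply (x : G) (a : A) : ‖α x a‖ = ‖a‖ := StarAlgEquiv.norm_map (α x) a

/-- The automorphisms of the action as continuous linear maps. -/
noncomputable def actionCLM (x : G) : A →L[ℂ] A :=
  LinearMap.mkContinuous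
    { toFun := α x, map_add' := map_add (α x), map_smul' := map_smul (α x) } 1
    fun a => by rw [one_mul]; exact (norm_action_apply α x a).le

theorem actionCLM_apply (x : G) (a : A) : actionCLM α x a = α x a := rfl

theorem mem_fixedPointAlgebra {a : A} : a ∈ fixedPointAlgebra α ↔ ∀ x, α x a = a := Iff.rfl

theorem isClosed_fixedPointAlgebra : IsClosed (fixedPointAlgebra α : Set A) := by
  have : (fixedPointAlgebra α : Set A) = ⋂ x, {a | actionCLM α x a = a} := by
    ext a
    simp [mem_fixedPointAlgebra, actionCLM_apply]
  rw [this]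
  exact isClosed_iInter fun x => isClosed_eq (actionCLM α x).continuous continuous_id

/-- The fixed points are closed, hence a C*-algebra, and injective *-homomorphisms of C*-algebras
are isometric. -/
theorem norm_map_fixedPointAlgebra {B : Type*} [CStarAlgebra B]
    (ι : fixedPointAlgebra α →⋆ₙₐ[ℂ] B) (hι : Function.Injective ι) (a : fixedPointAlgebra α) :
    ‖ι a‖ = ‖(a : A)‖ := by
  have := isClosed_fixedPointAlgebra α
  let _ : CStarAlgebra (fixedPointAlgebra α) :=
    StarSubalgebra.cstarAlgebra (h_closed := isClosed_fixedPointAlgebra α) _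
  exact NonUnitalStarAlgHom.norm_map ι hι a

theorem norm_action_sub_le {l : G → ℝ} (hl0 : l 1 = 0) (hlpos : ∀ x, x ≠ 1 → 0 < l x) {a : A}
    {C : ℝ} (hC : 0 ≤ C) (h : lengthSeminorm l α a ≤ ENNReal.ofReal C) (x : G) :
    ‖α x a - a‖ ≤ C * l x := by
  rcases eq_or_ne x 1 with rfl | hx
  · simp [hl0]
  · have h1 := (le_iSup₂ (f := fun (x : G) (_ : x ≠ 1) =>
      ENNReal.ofReal (‖α x a - a‖ / l x)) x hx).trans h
    rw [ENNReal.ofReal_le_ofReal_iff hC, div_le_iff₀ (hlpos x hx)] at h1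
    exact h1

end Action

section Average

variable {G : Type*} [Group G] [TopologicalSpace G] [CompactSpace G]
    [MeasurableSpace G] [BorelSpace G] (μ : Measure G) [IsFiniteMeasureOnCompacts μ]
    {A : Type*} [CStarAlgebra A] {α : G →* (A ≃⋆ₐ[ℂ] A)}
    (hα : ∀ a : A, Continuous fun x : G => α x a) {φ ψ : G → ℂ}
include hα

theorem integrable_average (hφ : Continuous φ) (a : A) : Integrable (fun x => φ x • α x a) μ :=
  integrable_of_continuous μ (hφ.smul (hα a))

theorem average_add_left (hφ : Continuous φ) (hψ : Continuous ψ) (a : A) :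
    average μ α (φ + ψ) a = average μ α φ a + average μ α ψ a := by
  simp only [average, Pi.add_apply, add_smul]
  exact integral_add (integrable_average μ hα hφ a) (integrable_average μ hα hψ a)

theorem average_sub_right (hφ : Continuous φ) (a b : A) :
    average μ α φ (a - b) = average μ α φ a - average μ α φ b := by
  simp only [average, map_sub, smul_sub]
  exact integral_sub (integrable_average μ hα hφ a) (integrable_average μ hα hφ b)

omit [BorelSpace G] [IsFiniteMeasureOnCompacts μ] [CompactSpace G] [TopologicalSpace G] hα in
theorem average_smul_left (c : ℂ) (a : A) : average μ α (c • φ) a = c • average μ α φ a := by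
  simp only [average, Pi.smul_apply, smul_assoc]
  exact integral_smul c _

omit [BorelSpace G] [IsFiniteMeasureOnCompacts μ] [CompactSpace G] [TopologicalSpace G] hα in
theorem norm_average_le (a : A) : ‖average μ α φ a‖ ≤ (∫ x, ‖φ x‖ ∂μ) * ‖a‖ := by
  refine (norm_integral_le_integral_norm _).trans (le_of_eq ?_)
  simp only [norm_smul, norm_action_apply]
  exact integral_mul_const _ _

omit [BorelSpace G] [IsFiniteMeasureOnCompacts μ] [CompactSpace G] [TopologicalSpace G] hα in
theorem average_of_fixed {a : A} (ha : ∀ x, α x a = a) :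
    average μ α φ a = (∫ x, φ x ∂μ) • a := by
  simp only [average, ha]
  exact integral_smul_const _ _

theorem norm_sub_average_le (hφ : Continuous φ) (hφ1 : ∫ x, φ x ∂μ = 1) {l : G → ℝ}
    (hl : Continuous l) {a : A} {C : ℝ} (h : ∀ x, ‖α x a - a‖ ≤ C * l x) :
    ‖a - average μ α φ a‖ ≤ C * ∫ x, ‖φ x‖ * l x ∂μ := by
  have e : a - average μ α φ a = ∫ x, φ x • (a - α x a) ∂μ := by
    have h1 : ∫ x, φ x • a ∂μ = a := by rw [integral_smul_const, hφ1, one_smul]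
    have h2 : Integrable (fun x => φ x • a) μ := integrable_of_continuous μ (by fun_prop)
    simp only [smul_sub]
    rw [integral_sub h2 (integrable_average μ hα hφ a), h1]
    rfl
  rw [e, ← integral_const_mul]
  refine norm_integral_le_of_norm_le (integrable_of_continuous μ (by fun_prop))
    (.of_forall fun x => ?_)
  rw [norm_smul, norm_sub_rev]
  calc ‖φ x‖ * ‖α x a - a‖ ≤ ‖φ x‖ * (C * l x) := by gcongr; exact h x
    _ = _ := by ring

end Average

section Isotypic

variable {G : Type*} [Group G] [TopologicalSpace G] [IsTopologicalGroup G] [CompactSpace G]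
    [MeasurableSpace G] [BorelSpace G] (μ : Measure G) [μ.IsHaarMeasure]
    {A : Type*} [CStarAlgebra A] {α : G →* (A ≃⋆ₐ[ℂ] A)}
    (hα : ∀ a : A, Continuous fun x : G => α x a)
include hα

theorem action_average (y : G) {φ : G → ℂ} (hφ : Continuous φ) (a : A) :
    α y (average μ α φ a) = average μ α (fun x => φ (y⁻¹ * x)) a := by
  have h := (actionCLM α y).integral_comp_comm (integrable_average μ hα hφ a)
  change ∫ x, α y (φ x • α x a) ∂μ = α y (average μ α φ a) at h
  rw [← h, average, ← integral_mul_left_eq_self (fun x => φ (y⁻¹ * x) • α x a) y]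
  congr 1
  ext x
  rw [map_smul, map_mul, StarAlgEquiv.mul_apply]
  simp

theorem average_one_fixed (a : A) (y : G) :
    α y (average μ α (fun _ => 1) a) = average μ α (fun _ => 1) a :=
  action_average μ hα y continuous_const a

/-- As a function of `v` this average intertwines `σ` with the action; by irreducibility it is zero
or embeds a copy of `σ` in `A`. -/
theorem average_matrixCoeff_mem_isotypicPart {n : ℕ} {σ : Representation ℂ G (Fin n → ℂ)}
    (hσ : IsContIrrep σ) (a : A) (j : Fin n) (v : Fin n → ℂ) :
    average μ α (fun x => σ x⁻¹ v j) a ∈ isotypicPart α σ := by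
  have hc : ∀ v, Continuous fun x => σ x⁻¹ v j := fun v =>
    (continuous_apply j).comp ((hσ.continuous v).comp continuous_inv)
  let e : (Fin n → ℂ) →ₗ[ℂ] A :=
    { toFun := fun v => average μ α (fun x => σ x⁻¹ v j) a
      map_add' := fun v w => by
        rw [← average_add_left μ hα (hc v) (hc w)]
        congr 1
        ext x
        simp
      map_smul' := fun c v => by
        rw [RingHom.id_apply, ← average_smul_left]
        congr 1
        ext x
        simp }
  have he : ∀ x v, e (σ x v) = α x (e v) := fun y v => by
    refine Eq.trans ?_ (action_average μ hα y (hc v) a).symm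
    change average μ α (fun x => σ x⁻¹ (σ y v) j) a = _
    congr 1
    ext x
    rw [← Module.End.mul_apply, ← map_mul, mul_inv_rev, inv_inv]
  change e v ∈ _
  rcases eq_bot_or_eq_top_of_isIrreducible hσ.irreducible e.ker (fun g v hv => by
    rw [LinearMap.mem_ker] at hv ⊢
    rw [he, hv, map_zero]) with h0 | h1
  · have hinj : Function.Injective e := LinearMap.ker_eq_bot.1 h0
    have hle : e.range ≤ isotypicPart α σ :=
      le_sSup ⟨LinearEquiv.ofInjective e hinj, fun x v => he x v⟩
    exact hle ⟨v, rfl⟩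
  · have : v ∈ e.ker := h1.ge Submodule.mem_top
    rw [LinearMap.mem_ker.1 this]
    exact zero_mem _

/-- The contragredient appears because `χ_π(x)` is the trace of the contragredient at `x⁻¹`, the
argument used in the matrix coefficients. -/
theorem average_character_mem_isotypicPart {n : ℕ} {π : Representation ℂ G (Fin n → ℂ)}
    (hπ : IsContIrrep π) (a : A) :
    average μ α π.character a ∈ isotypicPart α (contragredient π) := by
  have e : π.character = fun x => ∑ j, contragredient π x⁻¹ (Pi.single j 1) j := by
    ext x
    simp [character_eq_sum, contragredient_apply, LinearMap.toMatrix'_apply]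
  have hc : ∀ j, Continuous fun x => contragredient π x⁻¹ (Pi.single j 1) j := fun j =>
    (continuous_apply j).comp ((hπ.contragredient.continuous _).comp continuous_inv)
  rw [e, average]
  simp only [Finset.sum_smul]
  rw [integral_finsetSum _ fun j _ => integrable_average μ hα (hc j) a]
  exact sum_mem fun j _ =>
    average_matrixCoeff_mem_isotypicPart μ hα hπ.contragredient a j _

end Isotypic

section TotallyBounded

variable {A : Type*} [CStarAlgebra A] {L : ExtSeminorm A}

/-- Total boundedness of one ball in a subspace passes to all balls, by scaling. -/
theorem exists_isCompact_of_totallyBounded {W : Submodule ℂ A} {r : ℝ} (hr : 0 < r)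
    (h : TotallyBounded {a : A | a ∈ W ∧ L a ≤ 1 ∧ ‖a‖ ≤ r}) (m K : ℝ) :
    ∃ T : Set A, IsCompact T ∧
      ∀ a ∈ W, L a ≤ ENNReal.ofReal m → ‖a‖ ≤ K → a ∈ T := by
  set S := {a : A | a ∈ W ∧ L a ≤ 1 ∧ ‖a‖ ≤ r}
  -- Division by `t` brings `L` below 1 and the norm below `r`; the 1 keeps `t` positive.
  set t : ℝ := max (max m 1) (K / r)
  have ht1 : 1 ≤ t := (le_max_right _ _).trans (le_max_left _ _)
  have ht : 0 < t := by linarith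
  have hS : IsCompact (closure S) := h.closure.isCompact_of_isClosed isClosed_closure
  refine ⟨(fun a => (t : ℂ) • a) '' closure S, hS.image (continuous_const_smul _),
    fun a haW hLa hKa => ⟨((t⁻¹ : ℝ) : ℂ) • a, subset_closure ⟨W.smul_mem _ haW, ?_, ?_⟩, ?_⟩⟩
  · refine ExtSeminorm.smul_le_one ht (hLa.trans (ENNReal.ofReal_le_ofReal ?_))
    exact (le_max_left _ _).trans (le_max_left _ _)
  · rw [norm_smul, Complex.norm_real, Real.norm_of_nonneg (by positivity), inv_mul_le_iff₀ ht]
    have : K / r ≤ t := le_max_right _ _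
    rw [div_le_iff₀ hr] at this
    exact hKa.trans this
  · simp only
    rw [smul_smul, ← Complex.ofReal_mul, mul_inv_cancel₀ ht.ne', Complex.ofReal_one, one_smul]

theorem ExtSeminorm.sub_algebraMap_le (hscalar : ∀ c : ℂ, L (algebraMap ℂ A c) = 0) (a : A)
    (c : ℂ) : L (a - algebraMap ℂ A c) ≤ L a := by
  have h := L.add_le' a (algebraMap ℂ A (-c))
  rw [hscalar, add_zero, map_neg, ← sub_eq_add_neg] at h
  exact h

end TotallyBounded

/-! ### The fixed-point algebra inside `B` -/

section FixedPoints

variable {G : Type*} [Group G] {A : Type*} [CStarAlgebra A] {L : ExtSeminorm A}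
  {α : G →* (A ≃⋆ₐ[ℂ] A)} {B : Type*} [CStarAlgebra B] {LB : ExtSeminorm B}
  {ι : fixedPointAlgebra α →⋆ₙₐ[ℂ] B}

/-- The embedding is not assumed unital, but `ι 1` is a nonzero idempotent on which `LB` vanishes,
hence a scalar idempotent, hence 1. -/
theorem map_one_of_isLipNorm [Nontrivial A] (hscalar : ∀ c : ℂ, L (algebraMap ℂ A c) = 0)
    (hLB : IsLipNorm LB) (hι : Function.Injective ι)
    (hL : ∀ a : fixedPointAlgebra α, LB (ι a) = L (a : A)) : ι 1 = 1 := by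
  have h0 : LB (ι 1) = 0 := by
    rw [hL]
    simpa using hscalar 1
  obtain ⟨c, hc⟩ := (hLB.eq_zero_iff _).1 h0
  have hne : ι 1 ≠ 0 := fun h => one_ne_zero (hι (h.trans (map_zero ι).symm))
  have hc0 : c ≠ 0 := by
    rintro rfl
    exact hne (by rw [hc, map_zero])
  have hidem : ι 1 * ι 1 = ι 1 := by rw [← map_mul, mul_one]
  rw [hc, ← Algebra.commutes, ← Algebra.smul_def, Algebra.algebraMap_eq_smul_one] at hidem
  have h1 : c • (1 : B) = 1 := smul_right_injective B hc0 hidem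
  rw [hc, Algebra.algebraMap_eq_smul_one, h1]

theorem map_algebraMap_of_isLipNorm [Nontrivial A] (hscalar : ∀ c : ℂ, L (algebraMap ℂ A c) = 0)
    (hLB : IsLipNorm LB) (hι : Function.Injective ι)
    (hL : ∀ a : fixedPointAlgebra α, LB (ι a) = L (a : A)) (c : ℂ) :
    ι (algebraMap ℂ _ c) = algebraMap ℂ B c := by
  rw [Algebra.algebraMap_eq_smul_one, map_smul, map_one_of_isLipNorm hscalar hLB hι hL,
    Algebra.algebraMap_eq_smul_one]

theorem eq_algebraMap_of_fixed (hscalar : ∀ c : ℂ, L (algebraMap ℂ A c) = 0)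
    (hLB : IsLipNorm LB) (hι : Function.Injective ι)
    (hL : ∀ a : fixedPointAlgebra α, LB (ι a) = L (a : A)) {a : A}
    (ha : a ∈ fixedPointAlgebra α) (h0 : L a = 0) : ∃ c : ℂ, a = algebraMap ℂ A c := by
  rcases subsingleton_or_nontrivial A with _ | _
  · exact ⟨0, Subsingleton.elim _ _⟩
  obtain ⟨c, hc⟩ := (hLB.eq_zero_iff (ι ⟨a, ha⟩)).1 (by rw [hL]; exact h0)
  rw [← map_algebraMap_of_isLipNorm hscalar hLB hι hL] at hc
  exact ⟨c, congrArg Subtype.val (hι hc)⟩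

theorem nontrivial_codomain [Nontrivial A] (hι : Function.Injective ι) : Nontrivial B :=
  ⟨⟨ι 1, 0, fun h => one_ne_zero (hι (h.trans (map_zero ι).symm))⟩⟩

/-- Since `ι` is isometric and unital, the state transported to its range is a unital contraction
and extends by Hahn–Banach. -/
theorem exists_state_restrict_eq (hscalar : ∀ c : ℂ, L (algebraMap ℂ A c) = 0)
    (hLB : IsLipNorm LB) (hι : Function.Injective ι)
    (hL : ∀ a : fixedPointAlgebra α, LB (ι a) = L (a : A)) (φ : stateSpace A) :
    ∃ ψ : stateSpace B, ∀ a : fixedPointAlgebra α,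
      (ψ : WeakDual ℂ B) (ι a) = (φ : WeakDual ℂ A) a := by
  have := nontrivial_of_state φ
  have := nontrivial_codomain (A := A) hι
  let i : fixedPointAlgebra α →ₗ[ℂ] B := (ι : fixedPointAlgebra α →ₗ[ℂ] B)
  have hi : ∀ a, i a = ι a := fun a => rfl
  let e := LinearEquiv.ofInjective i hι
  let f : i.range →ₗ[ℂ] ℂ :=
    (φ : WeakDual ℂ A).toLinearMap ∘ₗ (fixedPointAlgebra α).toSubalgebra.toSubmodule.subtype ∘ₗ
      e.symm.toLinearMap
  have hf : ∀ a, f (e a) = (φ : WeakDual ℂ A) a := fun a => by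
    change (φ : WeakDual ℂ A) (e.symm (e a) : A) = _
    rw [e.symm_apply_apply]
  have he1 : (e 1 : B) = 1 := map_one_of_isLipNorm hscalar hLB hι hL
  have h1 : (1 : B) ∈ i.range := ⟨1, he1⟩
  obtain ⟨ψ, hψ⟩ := exists_state_extension i.range f (fun x => by
      obtain ⟨a, rfl⟩ := e.surjective x
      rw [hf]
      refine (norm_apply_le_of_mem_stateSpace φ.2 a).trans (le_of_eq ?_)
      exact (norm_map_fixedPointAlgebra α ι hι a).symm) h1 (by
      have : (⟨1, h1⟩ : i.range) = e 1 := Subtype.ext he1.symm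
      rw [this, hf]
      exact φ.2.2)
  exact ⟨ψ, fun a => (hψ (e a)).trans (hf a)⟩

theorem totallyBounded_fixed (hLB : IsLipNorm LB) (hι : Function.Injective ι)
    (hL : ∀ a : fixedPointAlgebra α, LB (ι a) = L (a : A)) (ψ : stateSpace B) :
    TotallyBounded (((↑) : fixedPointAlgebra α → A) ''
      {a | L (a : A) ≤ 1 ∧ (ψ : WeakDual ℂ B) (ι a) = 0}) := by
  have hiso : Isometry ι := AddMonoidHomClass.isometry_of_norm ι
    (norm_map_fixedPointAlgebra α ι hι)
  refine TotallyBounded.image ?_ uniformContinuous_subtype_val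
  refine (totallyBounded_preimage hiso.isUniformInducing (hLB.totallyBounded ψ)).subset ?_
  rintro a ⟨ha1, ha2⟩
  exact ⟨by rw [hL]; exact ha1, ha2⟩

end FixedPoints

/-! ### Compactness of averaged balls and comparison of distances -/

section Main

variable {G : Type*} [Group G] [TopologicalSpace G] [IsTopologicalGroup G] [CompactSpace G]
    [MeasurableSpace G] [BorelSpace G]
    (μ : Measure G) [μ.IsHaarMeasure] [IsProbabilityMeasure μ]
    {l : G → ℝ} (hl : IsLengthFunction l)
    {A : Type*} [CStarAlgebra A] {L : ExtSeminorm A}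
    {α : G →* (A ≃⋆ₐ[ℂ] A)} (hα : ∀ a : A, Continuous fun x : G => α x a)
    {C : ℝ} (hC : 0 < C)
    (h1 : ∀ a : A, lengthSeminorm l α a ≤ ENNReal.ofReal C * L a)
    (h2 : ∀ φ ∈ Submodule.span ℂ (irrChars G), ∀ a : A,
      L (average μ α φ a) ≤ ENNReal.ofReal (∫ x, ‖φ x‖ ∂μ) * L a)

include hl hC h1 in
theorem norm_action_sub_le_of_le_one {a : A} (ha : L a ≤ 1) (x : G) :
    ‖α x a - a‖ ≤ C * l x :=
  norm_action_sub_le α hl.map_one (fun _ hx => hl.pos hx) hC.le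
    ((h1 a).trans (mul_le_of_le_one_right' ha)) x

include hl h1 in
theorem fixed_of_eq_zero {a : A} (ha : L a = 0) : a ∈ fixedPointAlgebra α := fun x => by
  have h := norm_action_sub_le α hl.map_one (fun _ hx => hl.pos hx) (C := 0) le_rfl
    ((h1 a).trans (by simp [ha])) x
  rw [zero_mul] at h
  exact sub_eq_zero.1 (norm_le_zero_iff.1 h)

include hl hα hC h1 in
theorem norm_sub_average_one_le {a : A} (ha : L a ≤ 1) :
    ‖a - average μ α (fun _ => 1) a‖ ≤ C * ∫ x, l x ∂μ := by
  have h := norm_sub_average_le μ hα (φ := fun _ => 1) continuous_const (by simp) hl.continuous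
    (norm_action_sub_le_of_le_one hl hC h1 ha)
  simpa using h

include h2 in
theorem average_one_le_one {a : A} (ha : L a ≤ 1) : L (average μ α (fun _ => 1) a) ≤ 1 := by
  have h := h2 _ (Submodule.subset_span one_mem_irrChars) a
  simp only [norm_one, integral_const, probReal_univ, smul_eq_mul, mul_one, ENNReal.ofReal_one,
    one_mul] at h
  exact h.trans ha

variable (h3 : ∀ (n : ℕ) (π : Representation ℂ G (Fin n → ℂ)), IsContIrrep π → ¬ π.IsTrivial →
      (∃ r : ℝ, 0 < r ∧
        TotallyBounded {a : A | a ∈ isotypicPart α π ∧ L a ≤ 1 ∧ ‖a‖ ≤ r}))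

include hl hα hC h1 h2 h3 in
theorem exists_isCompact_average_character {n : ℕ} {π : Representation ℂ G (Fin n → ℂ)}
    (hπ : IsContIrrep π) (ht : ¬ π.IsTrivial) :
    ∃ T : Set A, IsCompact T ∧ ∀ a, L a ≤ 1 → average μ α π.character a ∈ T := by
  obtain ⟨r, hr, htb⟩ := h3 n _ hπ.contragredient
    fun h => ht (isTrivial_of_isTrivial_contragredient h)
  obtain ⟨T, hT, hT'⟩ := exists_isCompact_of_totallyBounded hr htb
    (∫ x, ‖π.character x‖ ∂μ) ((∫ x, ‖π.character x‖ ∂μ) * (C * ∫ x, l x ∂μ))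
  refine ⟨T, hT, fun a ha => hT' _ (average_character_mem_isotypicPart μ hα hπ a) ?_ ?_⟩
  · exact (h2 _ (Submodule.subset_span ⟨n, π, hπ, rfl⟩) a).trans (mul_le_of_le_one_right' ha)
  -- The ball of `L` contains all scalars, so `a` has no norm bound; but the average kills the fixed
  -- part, since `∫ χ_π = 0`, and `a - E a` is bounded.
  · have e : average μ α π.character a =
        average μ α π.character (a - average μ α (fun _ => 1) a) := by
      rw [average_sub_right μ hα hπ.continuous_character,
        average_of_fixed μ (average_one_fixed μ hα a), integral_character_eq_zero μ hπ ht,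
        zero_smul, sub_zero]
    rw [e]
    refine (norm_average_le μ _).trans ?_
    gcongr
    exact norm_sub_average_one_le μ hl hα hC h1 ha

variable {B : Type*} [CStarAlgebra B] {LB : ExtSeminorm B} (hLB : IsLipNorm LB)
    {ι : fixedPointAlgebra α →⋆ₙₐ[ℂ] B} (hι : Function.Injective ι)
    (h4 : ∀ a : fixedPointAlgebra α, LB (ι a) = L (a : A))
    (hscalar : ∀ c : ℂ, L (algebraMap ℂ A c) = 0)

include hα h2 hLB hι h4 hscalar in
theorem exists_isCompact_average_one [Nontrivial A] :
    ∃ T : Set A, IsCompact T ∧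
      ∀ a, L a ≤ 1 → ∃ c : ℂ, average μ α (fun _ => 1) a - algebraMap ℂ A c ∈ T := by
  have := nontrivial_codomain (A := A) hι
  -- Any state of `B` would do: it selects the scalar to subtract.
  obtain ⟨ψ, hψ, -⟩ := exists_state_norm_apply_eq (A := B) (.one B)
  refine ⟨_, (totallyBounded_fixed hLB hι h4 ⟨ψ, hψ⟩).closure.isCompact_of_isClosed
    isClosed_closure, fun a ha => ?_⟩
  let E : fixedPointAlgebra α := ⟨_, average_one_fixed μ hα a⟩
  refine ⟨ψ (ι E), subset_closure ⟨E - algebraMap ℂ _ (ψ (ι E)), ⟨?_, ?_⟩, rfl⟩⟩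
  · exact (ExtSeminorm.sub_algebraMap_le hscalar _ _).trans (average_one_le_one μ h2 ha)
  · change ψ _ = 0
    rw [map_sub, map_algebraMap_of_isLipNorm hscalar hLB hι h4, map_sub,
      Algebra.algebraMap_eq_smul_one (A := B), map_smul, hψ.2]
    simp

include hl hα hC h1 h2 h3 hLB hι h4 hscalar in
theorem exists_isCompact_average [Nontrivial A] {φ : G → ℂ}
    (hφ : φ ∈ Submodule.span ℂ (irrChars G)) :
    ∃ T : Set A, IsCompact T ∧
      ∀ a, L a ≤ 1 → ∃ c : ℂ, average μ α φ a - algebraMap ℂ A c ∈ T := by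
  induction hφ using Submodule.span_induction with
  | mem φ hφ =>
    obtain ⟨n, π, hπ, rfl⟩ := hφ
    by_cases ht : π.IsTrivial
    · obtain ⟨T, hT, hT'⟩ := exists_isCompact_average_one μ hα h2 hLB hι h4 hscalar
      refine ⟨_, hT.image (continuous_const_smul (n : ℂ)), fun a ha => ?_⟩
      obtain ⟨c, hc⟩ := hT' a ha
      refine ⟨n * c, _, hc, ?_⟩
      have e : π.character = (n : ℂ) • fun _ => (1 : ℂ) := by
        ext x
        simp [character_eq_sum, ht.out]
      rw [e, average_smul_left]
      simp [Algebra.smul_def, mul_sub]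
    · obtain ⟨T, hT, hT'⟩ := exists_isCompact_average_character μ hl hα hC h1 h2 h3 hπ ht
      exact ⟨T, hT, fun a ha => ⟨0, by simpa using hT' a ha⟩⟩
  | zero =>
    refine ⟨{0}, isCompact_singleton, fun a _ => ⟨0, ?_⟩⟩
    simp [average]
  | add φ ψ hφ hψ ihφ ihψ =>
    obtain ⟨S, hS, hS'⟩ := ihφ
    obtain ⟨T, hT, hT'⟩ := ihψ
    refine ⟨_, (hS.prod hT).image continuous_add, fun a ha => ?_⟩
    obtain ⟨c, hc⟩ := hS' a ha
    obtain ⟨d, hd⟩ := hT' a ha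
    refine ⟨c + d, (_, _), ⟨hc, hd⟩, ?_⟩
    rw [average_add_left μ hα (continuous_of_mem_span_irrChars hφ)
      (continuous_of_mem_span_irrChars hψ), map_add]
    exact (add_sub_add_comm _ _ _ _).symm
  | smul z φ _ ih =>
    obtain ⟨T, hT, hT'⟩ := ih
    refine ⟨_, hT.image (continuous_const_smul z), fun a ha => ?_⟩
    obtain ⟨c, hc⟩ := hT' a ha
    refine ⟨z * c, _, hc, ?_⟩
    rw [average_smul_left]
    simp [Algebra.smul_def, mul_sub]

include hl hα hC h1 h2 in
-- Pass from `φ₁(a)` to `φ₁(E a)`, `φ₂(E a)` and `φ₂(a)`: the outer steps cost `C ∫ l` each, and the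
-- middle one is seen by `LB`.
theorem stateDist_le_of_restrict_eq
    (h4 : ∀ a : fixedPointAlgebra α, LB (ι a) = L (a : A))
    {φ₁ φ₂ : stateSpace A} {ψ₁ ψ₂ : stateSpace B}
    (e₁ : ∀ a : fixedPointAlgebra α, (ψ₁ : WeakDual ℂ B) (ι a) = (φ₁ : WeakDual ℂ A) a)
    (e₂ : ∀ a : fixedPointAlgebra α, (ψ₂ : WeakDual ℂ B) (ι a) = (φ₂ : WeakDual ℂ A) a) :
    stateDist L φ₁ φ₂ ≤ stateDist LB ψ₁ ψ₂ + 2 * ENNReal.ofReal (C * ∫ x, l x ∂μ) := by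
  refine iSup₂_le fun a ha => ?_
  let E : fixedPointAlgebra α := ⟨_, average_one_fixed μ hα a⟩
  have hE : ‖a - E‖ ≤ C * ∫ x, l x ∂μ := norm_sub_average_one_le μ hl hα hC h1 ha
  have hed : ∀ φ : stateSpace A, edist ((φ : WeakDual ℂ A) a) ((φ : WeakDual ℂ A) E) ≤
      ENNReal.ofReal (C * ∫ x, l x ∂μ) := fun φ => by
    rw [edist_dist, dist_eq_norm, ← map_sub]
    exact ENNReal.ofReal_le_ofReal ((norm_apply_le_of_mem_stateSpace φ.2 _).trans hE)
  have hmid : edist ((φ₁ : WeakDual ℂ A) E) ((φ₂ : WeakDual ℂ A) E) ≤ stateDist LB ψ₁ ψ₂ := by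
    rw [← e₁, ← e₂]
    refine edist_le_stateDist ψ₁ ψ₂ ?_
    rw [h4]
    exact average_one_le_one μ h2 ha
  calc _ ≤ edist ((φ₁ : WeakDual ℂ A) a) ((φ₁ : WeakDual ℂ A) E) +
        edist ((φ₁ : WeakDual ℂ A) E) ((φ₂ : WeakDual ℂ A) E) +
        edist ((φ₂ : WeakDual ℂ A) E) ((φ₂ : WeakDual ℂ A) a) := edist_triangle4 _ _ _ _
    _ ≤ ENNReal.ofReal (C * ∫ x, l x ∂μ) + stateDist LB ψ₁ ψ₂ +
        ENNReal.ofReal (C * ∫ x, l x ∂μ) :=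
      add_le_add (add_le_add (hed φ₁) hmid) (by rw [edist_comm]; exact hed φ₂)
    _ = _ := by ring

end Main

end QuantumMetric

open QuantumMetric in
theorem theorem4p1
    {G : Type*} [Group G] [TopologicalSpace G] [IsTopologicalGroup G] [CompactSpace G]
    [MeasurableSpace G] [BorelSpace G]
    (μ : Measure G) [μ.IsHaarMeasure] [IsProbabilityMeasure μ]
    (l : G → ℝ) (hl : IsLengthFunction l)
    {A : Type*} [CStarAlgebra A] (L : ExtSeminorm A)
    (hreal : ∀ a : A, L (star a) = L a)
    (hdense : Dense {a : A | L a < ∞})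
    (hscalar : ∀ c : ℂ, L (algebraMap ℂ A c) = 0)
    (α : G →* (A ≃⋆ₐ[ℂ] A)) (hα : ∀ a : A, Continuous fun x : G => α x a)
    (C : ℝ) (hC : 0 < C)
    (h1 : ∀ a : A, lengthSeminorm l α a ≤ ENNReal.ofReal C * L a)
    (h2 : ∀ φ ∈ Submodule.span ℂ (irrChars G), ∀ a : A,
      L (average μ α φ a) ≤ ENNReal.ofReal (∫ x, ‖φ x‖ ∂μ) * L a)
    (h3 : ∀ (n : ℕ) (π : Representation ℂ G (Fin n → ℂ)), IsContIrrep π → ¬ π.IsTrivial →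
      (∃ r : ℝ, 0 < r ∧
        TotallyBounded {a : A | a ∈ isotypicPart α π ∧ L a ≤ 1 ∧ ‖a‖ ≤ r}) ∧
      ∀ a ∈ isotypicPart α π, L a = 0 → a = 0)
    {B : Type*} [CStarAlgebra B] (LB : ExtSeminorm B) (hLB : IsLipNorm LB)
    (ι : fixedPointAlgebra α →⋆ₙₐ[ℂ] B) (hι : Function.Injective ι)
    (h4 : ∀ a : fixedPointAlgebra α, LB (ι a) = L (a : A)) :
    IsLipNorm L ∧ radius L ≤ radius LB + ENNReal.ofReal (C * ∫ x, l x ∂μ) := by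
  have hdist : ∀ φ₁ φ₂ : stateSpace A, ∃ ψ₁ ψ₂ : stateSpace B,
      stateDist L φ₁ φ₂ ≤ stateDist LB ψ₁ ψ₂ + 2 * ENNReal.ofReal (C * ∫ x, l x ∂μ) := by
    intro φ₁ φ₂
    obtain ⟨ψ₁, e₁⟩ := exists_state_restrict_eq hscalar hLB hι h4 φ₁
    obtain ⟨ψ₂, e₂⟩ := exists_state_restrict_eq hscalar hLB hι h4 φ₂
    exact ⟨ψ₁, ψ₂, stateDist_le_of_restrict_eq μ hl hα hC h1 h2 h4 e₁ e₂⟩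
  refine ⟨⟨hreal, fun a => ⟨fun h => ?_, ?_⟩, fun φ₁ φ₂ => ?_, ?_⟩, ?_⟩
  · exact eq_algebraMap_of_fixed hscalar hLB hι h4 (fixed_of_eq_zero hl h1 h) h
  · rintro ⟨c, rfl⟩
    exact hscalar c
  · obtain ⟨ψ₁, ψ₂, h⟩ := hdist φ₁ φ₂
    exact ne_top_of_le_ne_top (ENNReal.add_ne_top.2 ⟨hLB.dist_ne_top _ _,
      ENNReal.mul_ne_top (by simp) ENNReal.ofReal_ne_top⟩) h
  · refine stateTopology_eq_of_totallyBounded hdense fun ε hε => ?_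
    rcases subsingleton_or_nontrivial A with _ | _
    · exact ⟨{0}, totallyBounded_singleton 0, fun a _ => ⟨0, 0, rfl, by
        rw [Subsingleton.elim (a - algebraMap ℂ A 0 - 0) 0, norm_zero]; exact hε.le⟩⟩
    obtain ⟨φ, hφ, hφ1, hφl⟩ :=
      -- The tolerance is `ε / C` because `α_φ` displaces the unit ball of `L` by at most `C ∫ |φ|
      -- l`.
      exists_mem_span_irrChars_concentrated μ hl (show 0 < ε / C by positivity)
    obtain ⟨T, hT, hT'⟩ := exists_isCompact_average μ hl hα hC h1 h2
      (fun n π hπ ht => (h3 n π hπ ht).1) hLB hι h4 hscalar hφ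
    refine ⟨T, hT.totallyBounded, fun a ha => ?_⟩
    obtain ⟨c, hc⟩ := hT' a ha
    refine ⟨c, _, hc, ?_⟩
    rw [sub_sub_sub_cancel_right]
    refine (norm_sub_average_le μ hα (continuous_of_mem_span_irrChars hφ) hφ1 hl.continuous
      (norm_action_sub_le_of_le_one hl hC h1 ha)).trans ?_
    rw [lt_div_iff₀' hC] at hφl
    exact hφl.le
  · have h : ⨆ (φ₁ : stateSpace A) (φ₂ : stateSpace A), stateDist L φ₁ φ₂ ≤
        (⨆ (ψ₁ : stateSpace B) (ψ₂ : stateSpace B), stateDist LB ψ₁ ψ₂) +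
          2 * ENNReal.ofReal (C * ∫ x, l x ∂μ) := by
      refine iSup₂_le fun φ₁ φ₂ => ?_
      obtain ⟨ψ₁, ψ₂, h⟩ := hdist φ₁ φ₂
      exact h.trans (add_le_add_left
        (le_iSup₂ (f := fun ψ₁ ψ₂ : stateSpace B => stateDist LB ψ₁ ψ₂) ψ₁ ψ₂) _)
    refine (ENNReal.div_le_div_right h 2).trans (le_of_eq ?_)
    rw [ENNReal.add_div, mul_comm, ENNReal.mul_div_cancel_right (by simp) (by simp)]
    rfl
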